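/- Let $\Lambda\in\{0,1,2,\dots\}$ and $k>0$, and let $\mathcal H_\Lambda$ be the complex Hilbert space of dimension $(\Lambda+1)^2$ with orthonormal basis $\psi_l^m$ ($0\le l\le\Lambda$, $-l\le m\le l$). On it the angular momentum components $L_1,L_2,L_3$ act by $$L_3\psi_l^m=m\,\psi_l^m,\qquad L_\pm\psi_l^m=\sqrt{(l\mp m)(l\pm m+1)}\;\psi_l^{m\pm1},\qquad L_\pm=L_1\pm iL_2,$$ and the fuzzy coordinates $x_1,x_2,x_3$ act through $x_\pm=x_1\pm ix_2$, $x_0=x_3$ by $$x_a\psi_l^m=c_lA_l^{a,m}\psi_{l-1}^{m+a}+c_{l+1}B_l^{a,m}\psi_{l+1}^{m+a}\qquad(a=0,+,-\ \text{standing for}\ 0,1,-1),$$ with $c_l=\sqrt{1+l^2/k}$ for $1\le l\le\Lambda$, $c_0=c_{\Lambda+1}=0$, and $$A_l^{0,m}=\sqrt{\tfrac{(l+m)(l-m)}{(2l+1)(2l-1)}},\qquad A_l^{\pm,m}=\pm\sqrt{\tfrac{(l\mp m)(l\mp m-1)}{(2l-1)(2l+1)}},\qquad B_l^{a,m}=A_{l+1}^{-a,m+a}$$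 (basis vectors with labels out of range are $0$). Let $\pi_\Lambda$ be the unitary representation of $SO(3)$ on $\mathcal H_\Lambda$ given in Euler angles by $\pi_\Lambda(g)=e^{i\varphi L_3}e^{i\theta L_2}e^{i\psi L_3}$ for $g=e^{\varphi I_3}e^{\theta I_2}e^{\psi I_3}$, where $$I_3=\begin{pmatrix}0&1&0\\-1&0&0\\0&0&0\end{pmatrix},\qquad I_2=\begin{pmatrix}0&0&-1\\0&0&0\\1&0&0\end{pmatrix},$$ and let $\mu$ be the invariant measure on $SO(3)$ of total mass $8\pi^2$. Let $\omega=\sum_{l=0}^{\Lambda}\sum_{h=-l}^{l}\omega_l^h\psi_l^h\in\mathcal H_\Lambda$ satisfy $$\sum_{h=-l}^{l}|\omega_l^h|^2=\frac{2l+1}{(\Lambda+1)^2}\qquad(l=0,1,\dots,\Lambda),$$ and put $\omega_g=\pi_\Lambda(g)\omega$, $P_g=\omega_g\langle\omega_g,\cdot\rangle$ for $g\in SO(3)$. Then $\{\omega_g\}_{g\in SO(3)}$ is a strong system of coherent states, that is, $g\mapsto\omega_g$ is continuous and the resolution of the identity $$I=\frac{(\Lambda+1)^2}{8\pi^2}\int_{SO(3)}d\mu(g)\,P_g$$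 holds on $\mathcal H_\Lambda$ (with a convergent integral). If moreover $\omega_l^h=\omega_l^{-h}$ for all $l,h$, then this system is fully $O(3)$-equivariant. That is, let $U$ be the extension of $\pi_\Lambda$ to $O(3)$ in which the inversion $-1$ acts by $\psi_l^m\mapsto(-1)^l\psi_l^m$; then for every $R\in O(3)$ the operator $U(R)$ is unitary, implements $R$ on the coordinates, $U(R)^{-1}x_iU(R)=\sum_jR_{ij}x_j$, and maps the set $\{\omega_g\}_{g\in SO(3)}$ onto itself. -/

import Mathlib

noncomputable section

namespace FuzzySphere

open Matrix MeasureTheory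

/-! ## The rotation group, Euler angles and the invariant measure -/

/-- The rotation group of three-dimensional Euclidean space. -/
abbrev SO3 : Type := ↥(Matrix.specialOrthogonalGroup (Fin 3) ℝ)

/-- The full orthogonal group of three-dimensional Euclidean space. -/
abbrev O3 : Type := ↥(Matrix.orthogonalGroup (Fin 3) ℝ)

/-- The matrix `exp (t I₃)` with `I₃ = !![0, 1, 0; -1, 0, 0; 0, 0, 0]`. -/
def rot3 (t : ℝ) : Matrix (Fin 3) (Fin 3) ℝ :=
  !![Real.cos t, Real.sin t, 0; -Real.sin t, Real.cos t, 0; 0, 0, 1]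

/-- The matrix `exp (t I₂)` with `I₂ = !![0, 0, -1; 0, 0, 0; 1, 0, 0]`. -/
def rot2 (t : ℝ) : Matrix (Fin 3) (Fin 3) ℝ :=
  !![Real.cos t, 0, -Real.sin t; 0, 1, 0; Real.sin t, 0, Real.cos t]

theorem SO3.mul_transpose (g : SO3) : (g : Matrix (Fin 3) (Fin 3) ℝ) * (g.1)ᵀ = 1 :=
  (Matrix.mem_orthogonalGroup_iff (Fin 3) ℝ).1 g.2.1

theorem SO3.det_eq_one (g : SO3) : (g : Matrix (Fin 3) (Fin 3) ℝ).det = 1 := g.2.2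

theorem rot3_mul_neg (t : ℝ) : rot3 t * rot3 (-t) = 1 := by
  have := Real.sin_sq_add_cos_sq t
  ext i j
  fin_cases i <;> fin_cases j <;>
    simp [rot3, Matrix.mul_apply, Fin.sum_univ_three] <;> nlinarith

theorem rot2_mul_neg (t : ℝ) : rot2 t * rot2 (-t) = 1 := by
  have := Real.sin_sq_add_cos_sq t
  ext i j
  fin_cases i <;> fin_cases j <;>
    simp [rot2, Matrix.mul_apply, Fin.sum_univ_three] <;> nlinarith

theorem rot3_transpose (t : ℝ) : (rot3 t)ᵀ = rot3 (-t) := by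
  ext i j
  fin_cases i <;> fin_cases j <;> simp [rot3]

theorem rot2_transpose (t : ℝ) : (rot2 t)ᵀ = rot2 (-t) := by
  ext i j
  fin_cases i <;> fin_cases j <;> simp [rot2]

theorem rot3_det (t : ℝ) : (rot3 t).det = 1 := by
  have := Real.sin_sq_add_cos_sq t
  simp [rot3, Matrix.det_fin_three]
  nlinarith

theorem rot2_det (t : ℝ) : (rot2 t).det = 1 := by
  have := Real.sin_sq_add_cos_sq t
  simp [rot2, Matrix.det_fin_three]
  nlinarith

/-- Every rotation has Euler angles. -/
theorem SO3.exists_euler (g : SO3) : ∃ a : ℝ × ℝ × ℝ,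
    (g : Matrix (Fin 3) (Fin 3) ℝ) = rot3 a.1 * rot2 a.2.1 * rot3 a.2.2 := by
  obtain ⟨g, hg⟩ := g
  have h1 : g * gᵀ = 1 := SO3.mul_transpose ⟨g, hg⟩
  have h2 : gᵀ * g = 1 := mul_eq_one_comm.1 h1
  have hd : g.det = 1 := SO3.det_eq_one ⟨g, hg⟩
  have hc : g 0 2 ^ 2 + g 1 2 ^ 2 + g 2 2 ^ 2 = 1 := by
    have := congrFun (congrFun h2 2) 2
    simp [Matrix.mul_apply, Fin.sum_univ_three] at this
    nlinarith
  set z : ℂ := ⟨-g 0 2, g 1 2⟩ with hz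
  set p := z.arg with hp
  set q := Real.arccos (g 2 2) with hq
  have hn : ‖z‖ = Real.sin q := by
    rw [hq, Real.sin_arccos, Complex.norm_def, Complex.normSq_mk]
    congr 1
    nlinarith
  have e0 : g 0 2 = -(Real.sin q * Real.cos p) := by
    have := Complex.norm_mul_cos_arg z
    rw [hn] at this
    rw [this]; simp [hz]
  have e1 : g 1 2 = Real.sin q * Real.sin p := by
    have := Complex.norm_mul_sin_arg z
    rw [hn] at this
    rw [this]
  have e2 : g 2 2 = Real.cos q := by
    rw [hq, Real.cos_arccos] <;> nlinarith [sq_nonneg (g 0 2), sq_nonneg (g 1 2)]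
  have sp := Real.sin_sq_add_cos_sq p
  have sq' := Real.sin_sq_add_cos_sq q
  obtain ⟨h, hh⟩ : ∃ h, h = rot2 (-q) * (rot3 (-p) * g) := ⟨_, rfl⟩
  have hgh : g = rot3 p * rot2 q * h := by
    rw [hh, Matrix.mul_assoc, ← Matrix.mul_assoc (rot2 q), rot2_mul_neg, Matrix.one_mul,
      ← Matrix.mul_assoc, rot3_mul_neg, Matrix.one_mul]
  have c0 : h 0 2 = 0 := by
    simp only [hh, rot2, rot3, Matrix.mul_apply, Fin.sum_univ_three, e0, e1, e2]
    simp
    linear_combination (-(Real.sin q * Real.cos q)) * sp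
  have c1 : h 1 2 = 0 := by
    simp only [hh, rot2, rot3, Matrix.mul_apply, Fin.sum_univ_three, e0, e1, e2]
    simp
    ring
  have c2 : h 2 2 = 1 := by
    simp only [hh, rot2, rot3, Matrix.mul_apply, Fin.sum_univ_three, e0, e1, e2]
    simp
    linear_combination (Real.sin q ^ 2) * sp + sq'
  have ho : h * hᵀ = 1 := by
    have r3 := rot3_mul_neg (-p)
    have r2 := rot2_mul_neg (-q)
    rw [hh, Matrix.transpose_mul, Matrix.transpose_mul, rot3_transpose, rot2_transpose]
    calc rot2 (-q) * (rot3 (-p) * g) * (gᵀ * rot3 (- -p) * rot2 (- -q))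
        = rot2 (-q) * (rot3 (-p) * (g * gᵀ) * rot3 (- -p)) * rot2 (- -q) := by
          simp only [Matrix.mul_assoc]
      _ = 1 := by rw [h1, Matrix.mul_one, r3, Matrix.mul_one, r2]
  have hdet : h.det = 1 := by
    rw [hh, Matrix.det_mul, Matrix.det_mul, rot2_det, rot3_det, hd]; norm_num
  have o22 := congrFun (congrFun ho 2) 2
  have o00 := congrFun (congrFun ho 0) 0
  have o01 := congrFun (congrFun ho 0) 1
  simp only [Matrix.mul_apply, Fin.sum_univ_three, Matrix.transpose_apply, c0, c1, c2,
    Matrix.one_apply_eq, mul_zero, add_zero, mul_one] at o22 o00 o01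
  rw [Matrix.one_apply_ne (by decide)] at o01
  have c20 : h 2 0 = 0 := by
    have := mul_self_nonneg (h 2 0)
    have := mul_self_nonneg (h 2 1)
    exact mul_self_eq_zero.1 (by linarith)
  have c21 : h 2 1 = 0 := by
    have := mul_self_nonneg (h 2 0)
    have := mul_self_nonneg (h 2 1)
    exact mul_self_eq_zero.1 (by linarith)
  rw [Matrix.det_fin_three] at hdet
  simp [c0, c1, c2, c20, c21] at hdet
  have c11 : h 1 1 = h 0 0 := by
    linear_combination h 0 0 * hdet - h 1 1 * o00 + h 0 1 * o01
  have c10 : h 1 0 = -h 0 1 := by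
    linear_combination (-h 1 0) * o00 + h 0 0 * o01 - h 0 1 * hdet
  set w : ℂ := ⟨h 0 0, h 0 1⟩ with hw
  have hwn : ‖w‖ = 1 := by
    rw [Complex.norm_def, Complex.normSq_mk, o00, Real.sqrt_one]
  have w0 : h 0 0 = Real.cos w.arg := by
    have := Complex.norm_mul_cos_arg w
    rw [hwn, one_mul] at this
    rw [this]
  have w1 : h 0 1 = Real.sin w.arg := by
    have := Complex.norm_mul_sin_arg w
    rw [hwn, one_mul] at this
    rw [this]
  have hr : h = rot3 w.arg := by
    ext i j
    fin_cases i <;> fin_cases j <;>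
      simp [rot3, c0, c1, c2, c20, c21, c11, c10, ← w0, ← w1]
  exact ⟨(p, q, w.arg), by rw [← hr]; exact hgh⟩

/-- Euler angles `(φ, θ, ψ)` of a rotation, `g = exp (φ I₃) exp (θ I₂) exp (ψ I₃)`. -/
def eulerAngles (g : SO3) : ℝ × ℝ × ℝ := Classical.choose g.exists_euler

theorem eulerAngles_spec (g : SO3) : (g : Matrix (Fin 3) (Fin 3) ℝ) =
    rot3 (eulerAngles g).1 * rot2 (eulerAngles g).2.1 * rot3 (eulerAngles g).2.2 :=
  Classical.choose_spec g.exists_euler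

theorem SO3.coe_inv (g : SO3) : ((g⁻¹ : SO3) : Matrix (Fin 3) (Fin 3) ℝ) = (g.1)ᵀ := by
  have h1 := SO3.mul_transpose g
  have h2 : (g.1)ᵀ * g.1 = 1 := mul_eq_one_comm.1 h1
  have h3 : (g : Matrix (Fin 3) (Fin 3) ℝ) * ((g⁻¹ : SO3) : Matrix (Fin 3) (Fin 3) ℝ) = 1 := by
    have : g * g⁻¹ = 1 := mul_inv_cancel g
    exact congrArg Subtype.val this
  calc ((g⁻¹ : SO3) : Matrix (Fin 3) (Fin 3) ℝ)
      = ((g.1)ᵀ * g.1) * ((g⁻¹ : SO3) : Matrix (Fin 3) (Fin 3) ℝ) := by rw [h2, Matrix.one_mul]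
    _ = (g.1)ᵀ := by rw [Matrix.mul_assoc, h3, Matrix.mul_one]

instance : IsTopologicalGroup SO3 where
  continuous_mul := continuous_mul
  continuous_inv := by
    refine Continuous.subtype_mk (f := fun g : SO3 => ((g⁻¹ : SO3) : Matrix (Fin 3) (Fin 3) ℝ)) ?_ _
    simp only [SO3.coe_inv]
    exact continuous_subtype_val.matrix_transpose

theorem SO3.isCompact :
    IsCompact ((Matrix.specialOrthogonalGroup (Fin 3) ℝ : Set (Matrix (Fin 3) (Fin 3) ℝ))) := by
  have hK : IsCompact (Set.univ.pi fun _ : Fin 3 => Set.univ.pi fun _ : Fin 3 =>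
      Set.Icc (-1 : ℝ) 1) := isCompact_univ_pi fun _ => isCompact_univ_pi fun _ => isCompact_Icc
  refine IsCompact.of_isClosed_subset (X := Matrix (Fin 3) (Fin 3) ℝ) hK ?_ ?_
  · have : (Matrix.specialOrthogonalGroup (Fin 3) ℝ : Set (Matrix (Fin 3) (Fin 3) ℝ)) =
        {A | A * Aᵀ = 1} ∩ {A | A.det = 1} := by
      ext A
      exact and_congr (Matrix.mem_orthogonalGroup_iff (Fin 3) ℝ) Iff.rfl
    rw [this]
    exact (isClosed_eq (continuous_id.matrix_mul continuous_id.matrix_transpose)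
      continuous_const).inter (isClosed_eq continuous_id.matrix_det continuous_const)
  · intro A hA i _ j _
    have h := congrFun (congrFun (SO3.mul_transpose ⟨A, hA⟩) i) i
    simp only [Matrix.mul_apply, Matrix.transpose_apply, Matrix.one_apply_eq] at h
    have h' : A i j * A i j ≤ 1 := by
      rw [← h]
      exact Finset.single_le_sum (f := fun j => A i j * A i j)
        (fun j _ => mul_self_nonneg _) (Finset.mem_univ j)
    constructor <;> nlinarith

instance : CompactSpace SO3 := isCompact_iff_compactSpace.1 SO3.isCompact

instance : MeasurableSpace SO3 := borel SO3

instance : BorelSpace SO3 := ⟨rfl⟩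

/-- The invariant measure `μ` of `SO(3)`, normalised (as in Euler angles, where it reads
`sin θ dφ dθ dψ`) to have total mass `8π²`. -/
def invMeasure : Measure SO3 :=
  ENNReal.ofReal (8 * Real.pi ^ 2) • Measure.haarMeasure ⊤

/-! ## The Hilbert space and its operators -/

/-- The labels `(l, m)` of the preferred basis: `0 ≤ l ≤ Λ` and `-l ≤ m ≤ l`. -/
abbrev Idx (Λ : ℕ) : Type :=
  Σ l : ↥(Finset.Icc (0 : ℤ) (Λ : ℤ)), ↥(Finset.Icc (-(l : ℤ)) (l : ℤ))

/-- The Hilbert space of the fuzzy sphere with cutoff `Λ`, in coordinates with respect to its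
preferred orthonormal basis; it has dimension `(Λ + 1)²`. -/
abbrev Hilb (Λ : ℕ) : Type := EuclideanSpace ℂ (Idx Λ)

/-- The algebra of observables. -/
abbrev Obs (Λ : ℕ) : Type := Hilb Λ →L[ℂ] Hilb Λ

variable (Λ : ℕ)

/-- The basis vector `ψ_l^m`; by convention it is `0` if the labels are out of range. -/
def psi (l m : ℤ) : Hilb Λ :=
  WithLp.toLp 2 fun p : Idx Λ => if (p.1 : ℤ) = l ∧ (p.2 : ℤ) = m then 1 else 0

/-- The operator that sends the basis vector `ψ_l^m` to `f l m`. -/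
def opOfBasis (f : ℤ → ℤ → Hilb Λ) : Obs Λ :=
  ∑ p : Idx Λ, (EuclideanSpace.proj p : Hilb Λ →L[ℂ] ℂ).smulRight (f p.1 p.2)

/-- `L₀ ψ_l^m = m ψ_l^m`. -/
def L0 : Obs Λ := opOfBasis Λ fun l m => (m : ℂ) • psi Λ l m

/-- `L₊ ψ_l^m = √((l - m)(l + m + 1)) ψ_l^{m+1}`. -/
def Lplus : Obs Λ := opOfBasis Λ fun l m =>
  ((√(((l - m) * (l + m + 1) : ℤ) : ℝ) : ℝ) : ℂ) • psi Λ l (m + 1)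

/-- `L₋ ψ_l^m = √((l + m)(l - m + 1)) ψ_l^{m-1}`. -/
def Lminus : Obs Λ := opOfBasis Λ fun l m =>
  ((√(((l + m) * (l - m + 1) : ℤ) : ℝ) : ℝ) : ℂ) • psi Λ l (m - 1)

/-- The angular momentum component `L₂`, where `L₊ = L₁ + i L₂` and `L₋ = L₁ - i L₂`. -/
def L2 : Obs Λ := (1 / (2 * Complex.I)) • (Lplus Λ - Lminus Λ)

/-- The angular momentum component `L₃`. -/
def L3 : Obs Λ := L0 Λ

/-- The coefficient `A_l^{a,m}`, for `a = 0, 1, -1`. -/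
def coefA (a l m : ℤ) : ℝ :=
  if a = 0 then √((((l + m) * (l - m) : ℤ) : ℝ) / (((2 * l + 1) * (2 * l - 1) : ℤ) : ℝ))
  else (a : ℝ) *
    √((((l - a * m) * (l - a * m - 1) : ℤ) : ℝ) / (((2 * l - 1) * (2 * l + 1) : ℤ) : ℝ))

/-- The coefficient `B_l^{a,m} = A_{l+1}^{-a,m+a}`. -/
def coefB (a l m : ℤ) : ℝ := coefA (-a) (l + 1) (m + a)

/-- The coefficient `c_l = √(1 + l²/k)` for `1 ≤ l ≤ Λ`, and `0` otherwise. -/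
def coefC (k : ℝ) (l : ℤ) : ℝ := if 1 ≤ l ∧ l ≤ (Λ : ℤ) then √(1 + (l : ℝ) ^ 2 / k) else 0

/-- The coordinates `x₊`, `x₋`, `x₀` of the fuzzy sphere are the cases `a = 1`, `-1`, `0`:
`x_a ψ_l^m = c_l A_l^{a,m} ψ_{l-1}^{m+a} + c_{l+1} B_l^{a,m} ψ_{l+1}^{m+a}`. -/
def xa (k : ℝ) (a : ℤ) : Obs Λ := opOfBasis Λ fun l m =>
  ((coefC Λ k l * coefA a l m : ℝ) : ℂ) • psi Λ (l - 1) (m + a) +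
    ((coefC Λ k (l + 1) * coefB a l m : ℝ) : ℂ) • psi Λ (l + 1) (m + a)

/-- The hermitean Cartesian coordinates `x₁, x₂, x₃` of the fuzzy sphere, where
`x₊ = x₁ + i x₂`, `x₋ = x₁ - i x₂` and `x₀ = x₃`. -/
def x (k : ℝ) : Fin 3 → Obs Λ :=
  ![(1 / 2 : ℂ) • (xa Λ k 1 + xa Λ k (-1)),
    (1 / (2 * Complex.I)) • (xa Λ k 1 - xa Λ k (-1)),
    xa Λ k 0]

/-! ## The action of rotations and of all orthogonal transformations -/

/-- The unitary representation of `SO(3)` on the Hilbert space, obtained by exponentiating the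
angular momentum: `π_Λ(g) = exp (i φ L₃) exp (i θ L₂) exp (i ψ L₃)` if
`g = exp (φ I₃) exp (θ I₂) exp (ψ I₃)`. Since the `I_a ↦ i L_a` represent the Lie algebra and
`L₃` has integer eigenvalues, the result is independent of the choice of the Euler angles. -/
def rep (g : SO3) : Obs Λ :=
  NormedSpace.exp ((Complex.I * ((eulerAngles g).1 : ℂ)) • L3 Λ) *
    NormedSpace.exp ((Complex.I * ((eulerAngles g).2.1 : ℂ)) • L2 Λ) *
    NormedSpace.exp ((Complex.I * ((eulerAngles g).2.2 : ℂ)) • L3 Λ)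

/-- The operator of the inversion `x ↦ -x`; it is `(-1)^l` on `V_l`, as for spherical harmonics. -/
def parity : Obs Λ := opOfBasis Λ fun l m => ((-1 : ℂ) ^ l) • psi Λ l m

theorem O3.mem_SO3 (R : O3) (h : (R : Matrix (Fin 3) (Fin 3) ℝ).det = 1) :
    (R : Matrix (Fin 3) (Fin 3) ℝ) ∈ Matrix.specialOrthogonalGroup (Fin 3) ℝ := ⟨R.2, h⟩

theorem O3.neg_mem_SO3 (R : O3) (h : ¬ (R : Matrix (Fin 3) (Fin 3) ℝ).det = 1) :
    -(R : Matrix (Fin 3) (Fin 3) ℝ) ∈ Matrix.specialOrthogonalGroup (Fin 3) ℝ := by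
  have h1 : (R : Matrix (Fin 3) (Fin 3) ℝ) * (R.1)ᵀ = 1 :=
    (Matrix.mem_orthogonalGroup_iff (Fin 3) ℝ).1 R.2
  refine ⟨(Matrix.mem_orthogonalGroup_iff (Fin 3) ℝ).2 (by simpa using h1), ?_⟩
  have h2 := congrArg Matrix.det h1
  rw [Matrix.det_mul, Matrix.det_transpose, Matrix.det_one] at h2
  have h3 : (R : Matrix (Fin 3) (Fin 3) ℝ).det = -1 := (mul_self_eq_one_iff.1 h2).resolve_left h
  change (-(R : Matrix (Fin 3) (Fin 3) ℝ)).det = 1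
  rw [Matrix.det_neg, h3]
  norm_num

open Classical in
/-- The representation of `O(3)` that extends `π_Λ`: a rotation `R` acts by `π_Λ(R)`, and
`R = -g` with `g` a rotation acts by `π_Λ(g)` composed with the inversion. -/
def repO3 (R : O3) : Obs Λ :=
  if h : (R : Matrix (Fin 3) (Fin 3) ℝ).det = 1 then rep Λ ⟨R, R.mem_SO3 h⟩
  else rep Λ ⟨-R, R.neg_mem_SO3 h⟩ * parity Λ

/-- The system of vectors `S` is fully `O(3)`-equivariant: each orthogonal transformation `R` of
the coordinates is implemented by the unitary `U(R)`, in the sense that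
`U(R)⁻¹ x_i U(R) = ∑_j R_ij x_j`, and `U(R)` maps `S` onto itself. -/
def IsFullyO3Equivariant (k : ℝ) (S : Set (Hilb Λ)) : Prop :=
  ∀ R : O3, repO3 Λ R ∈ unitary (Obs Λ) ∧
    (∀ i, star (repO3 Λ R) * x Λ k i * repO3 Λ R =
      ∑ j, (((R : Matrix (Fin 3) (Fin 3) ℝ) i j : ℝ) : ℂ) • x Λ k j) ∧
    repO3 Λ R '' S = S

variable {Λ}

/-- The operator `v ⟨v, ·⟩`, the orthogonal projector on the line of `v` if `v` is a unit
vector. -/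
def proj (v : Hilb Λ) : Obs Λ := InnerProductSpace.rankOne ℂ v v

variable (Λ)

/-- The vector `ω = ∑_{l=0}^Λ ∑_{h=-l}^l w_l^h ψ_l^h`. -/
def vec (w : ℤ → ℤ → ℂ) : Hilb Λ :=
  ∑ l ∈ Finset.Icc (0 : ℤ) (Λ : ℤ), ∑ h ∈ Finset.Icc (-l) l, w l h • psi Λ l h

/-- The coherent state `ω_g = π_Λ(g) ω`. -/
def coherent (ω : Hilb Λ) (g : SO3) : Hilb Λ := rep Λ g ω

end FuzzySphere

end

/-!
Everything rests on the uniqueness of implementers. Say that an operator `U` implements a matrix `g`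
if it is unitary, fixes `ψ_0^0`, and satisfies `U⁻¹ xᵢ U = ∑ⱼ gᵢⱼ xⱼ` (`Implements`). The commutators
`[L_a, x_b]`, which come down to identities between square roots, show that `exp (i t L₃)` implements
`rot3 t` and `exp (i t L₂)` implements `rot2 t`; hence `π_Λ(g)` implements `g` (`implements_rep`). As
all `c_l` with `1 ≤ l ≤ Λ` are positive, the vector `ψ_0^0` is cyclic for the coordinates
(`psi_mem_of_invariant`), so that an operator which commutes with them and fixes `ψ_0^0` is `1`.
Therefore `g` has only one implementer (`Implements.unique`).

This replaces the usual integration of a representation of the Lie algebra: it gives at once the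
independence of the Euler angles, the multiplicativity of `π_Λ`, and its continuity, since the graph
of `π_Λ` is the closed set of the pairs `(g, U)` in which `U` implements `g`, and the unitary group
is compact (`continuous_rep`). Neither the representation nor the coherent states depend on `k`, so
these facts are derived from the coordinates with `k = 1`.

For the resolution of the identity, the operator `T = ∫ P_g dμ(g)` commutes with the representation
because `μ` is invariant, so it is a scalar `τ_l` on each `V_l`, the span of the `ψ_l^m` with `l`
fixed (`exists_scalar_of_commute_rep`). The trace of `T` over `V_l` is `(2l + 1) τ_l`, and it is also
the integral of the squared norm of the component of `ω_g` in `V_l`, which does not depend on `g`; the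
normalisation of `ω` makes all `τ_l` equal to `8π² / (Λ + 1)²`.

For the equivariance, the inversion anticommutes with the coordinates and commutes with the rotations,
and the half turn around the first axis is implemented by `ψ_l^m ↦ (-1)^l ψ_l^{-m}`
(`rep_halfTurn`). On a vector with `ω_l^h = ω_l^{-h}` this half turn agrees with the inversion, so
that the inversion only permutes the coherent states.
-/

noncomputable section

namespace FuzzySphere

open Matrix MeasureTheory

/-! ### The basis and the action of the operators on it -/

/-- The labels `(l, m)` of a nonzero basis vector `ψ_l^m`. -/
def InRange (Λ : ℕ) (l m : ℤ) : Prop := 0 ≤ l ∧ l ≤ Λ ∧ -l ≤ m ∧ m ≤ l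

variable {Λ : ℕ}

theorem InRange.neg {l m : ℤ} (h : InRange Λ l m) : InRange Λ l (-m) := by
  unfold InRange at *; omega

theorem inRange_coe (p : Idx Λ) : InRange Λ p.1 p.2 := by
  obtain ⟨⟨l, hl⟩, ⟨m, hm⟩⟩ := p
  simp only [Finset.mem_Icc] at hl hm
  exact ⟨hl.1, hl.2, hm.1, hm.2⟩

theorem exists_idx {l m : ℤ} (h : InRange Λ l m) :
    ∃ p : Idx Λ, (p.1 : ℤ) = l ∧ (p.2 : ℤ) = m :=
  ⟨⟨⟨l, Finset.mem_Icc.2 ⟨h.1, h.2.1⟩⟩, ⟨m, Finset.mem_Icc.2 h.2.2⟩⟩, rfl, rfl⟩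

theorem idx_ext {p q : Idx Λ} (h1 : (p.1 : ℤ) = q.1) (h2 : (p.2 : ℤ) = q.2) : p = q := by
  obtain ⟨⟨l, hl⟩, ⟨m, hm⟩⟩ := p
  obtain ⟨⟨l', hl'⟩, ⟨m', hm'⟩⟩ := q
  simp only at h1 h2
  subst h1 h2
  rfl

theorem psi_apply (l m : ℤ) (p : Idx Λ) :
    psi Λ l m p = if (p.1 : ℤ) = l ∧ (p.2 : ℤ) = m then 1 else 0 := rfl

theorem psi_eq_zero {l m : ℤ} (h : ¬ InRange Λ l m) : psi Λ l m = 0 := by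
  ext p
  rw [psi_apply, if_neg]
  · rfl
  · rintro ⟨rfl, rfl⟩
    exact h (inRange_coe p)

theorem psi_coe (p : Idx Λ) : psi Λ p.1 p.2 = EuclideanSpace.single p 1 := by
  ext q
  rw [psi_apply, PiLp.single_apply]
  exact if_congr ⟨fun h => idx_ext h.1 h.2, fun h => by subst h; simp⟩ rfl rfl

theorem obs_ext {S T : Obs Λ} (h : ∀ l m, InRange Λ l m → S (psi Λ l m) = T (psi Λ l m)) :
    S = T := by
  apply ContinuousLinearMap.coe_injective
  refine (EuclideanSpace.basisFun (Idx Λ) ℂ).toBasis.ext fun p => ?_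
  simpa [psi_coe] using h p.1 p.2 (inRange_coe p)

theorem inner_psi_left {l m : ℤ} (h : InRange Λ l m) (v : Hilb Λ) (p : Idx Λ)
    (h1 : (p.1 : ℤ) = l) (h2 : (p.2 : ℤ) = m) : inner ℂ (psi Λ l m) v = v p := by
  subst h1 h2
  rw [psi_coe, EuclideanSpace.inner_single_left]
  simp

theorem inner_psi_psi {l m : ℤ} (h : InRange Λ l m) (l' m' : ℤ) :
    inner ℂ (psi Λ l m) (psi Λ l' m') = if l = l' ∧ m = m' then 1 else 0 := by
  obtain ⟨p, rfl, rfl⟩ := exists_idx h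
  rw [inner_psi_left h _ p rfl rfl, psi_apply]

/-- An operator agrees with its defining formula also at labels out of range, provided that the
formula gives `0` there. -/
theorem opOfBasis_psi {f : ℤ → ℤ → Hilb Λ} {l m : ℤ} (hf : ¬ InRange Λ l m → f l m = 0) :
    opOfBasis Λ f (psi Λ l m) = f l m := by
  by_cases h : InRange Λ l m
  · obtain ⟨p, rfl, rfl⟩ := exists_idx h
    simp [opOfBasis, psi_coe]
  · rw [hf h, psi_eq_zero h, map_zero]

/-- The coefficient `√((l - m)(l + m + 1))` of the raising operator. -/
def raiseCoef (l m : ℤ) : ℝ := √(((l - m) * (l + m + 1) : ℤ) : ℝ)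

theorem Lplus_psi (l m : ℤ) :
    Lplus Λ (psi Λ l m) = (raiseCoef l m : ℂ) • psi Λ l (m + 1) := by
  refine opOfBasis_psi fun h => ?_
  by_cases h' : InRange Λ l (m + 1)
  · have : l + m + 1 = 0 := by unfold InRange at *; omega
    simp [this]
  · rw [psi_eq_zero h', smul_zero]

theorem Lminus_psi (l m : ℤ) :
    Lminus Λ (psi Λ l m) = (raiseCoef l (-m) : ℂ) • psi Λ l (m - 1) := by
  rw [raiseCoef, sub_neg_eq_add, ← sub_eq_add_neg]
  refine opOfBasis_psi fun h => ?_
  by_cases h' : InRange Λ l (m - 1)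
  · have : l - m + 1 = 0 := by unfold InRange at *; omega
    simp [this]
  · rw [psi_eq_zero h', smul_zero]

theorem L3_psi (l m : ℤ) : L3 Λ (psi Λ l m) = (m : ℂ) • psi Λ l m :=
  opOfBasis_psi fun h => by rw [psi_eq_zero h, smul_zero]

theorem parity_psi (l m : ℤ) : parity Λ (psi Λ l m) = ((-1 : ℂ) ^ l) • psi Λ l m :=
  opOfBasis_psi fun h => by rw [psi_eq_zero h, smul_zero]

theorem coefC_eq_zero {k : ℝ} {l : ℤ} (h : ¬ (1 ≤ l ∧ l ≤ (Λ : ℤ))) : coefC Λ k l = 0 := if_neg h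

theorem coefC_pos {k : ℝ} (hk : 0 < k) {l : ℤ} (h : 1 ≤ l ∧ l ≤ (Λ : ℤ)) : 0 < coefC Λ k l := by
  rw [coefC, if_pos h]; positivity

theorem coefA_zero (l m : ℤ) : coefA 0 l m =
    √((((l + m) * (l - m) : ℤ) : ℝ) / (((2 * l + 1) * (2 * l - 1) : ℤ) : ℝ)) := if_pos rfl

theorem coefA_one (l m : ℤ) : coefA 1 l m =
    √((((l - m) * (l - m - 1) : ℤ) : ℝ) / (((2 * l + 1) * (2 * l - 1) : ℤ) : ℝ)) := by
  rw [coefA, if_neg one_ne_zero, mul_comm (2 * l - 1)]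
  simp

theorem coefA_neg_one (l m : ℤ) : coefA (-1) l m =
    -√((((l + m) * (l + m - 1) : ℤ) : ℝ) / (((2 * l + 1) * (2 * l - 1) : ℤ) : ℝ)) := by
  rw [coefA, if_neg (by decide), mul_comm (2 * l - 1)]
  simp

theorem xa_psi (k : ℝ) {a : ℤ} (ha : a = 0 ∨ a = 1 ∨ a = -1) (l m : ℤ) :
    xa Λ k a (psi Λ l m) =
      ((coefC Λ k l * coefA a l m : ℝ) : ℂ) • psi Λ (l - 1) (m + a) +
        ((coefC Λ k (l + 1) * coefA (-a) (l + 1) (m + a) : ℝ) : ℂ) • psi Λ (l + 1) (m + a) := by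
  refine opOfBasis_psi fun h => ?_
  have h1 : ((coefC Λ k l * coefA a l m : ℝ) : ℂ) • psi Λ (l - 1) (m + a) = 0 := by
    by_cases h' : InRange Λ (l - 1) (m + a)
    · rw [coefC_eq_zero (by unfold InRange at *; omega)]; simp
    · rw [psi_eq_zero h', smul_zero]
  have h2 : ((coefC Λ k (l + 1) * coefB a l m : ℝ) : ℂ) • psi Λ (l + 1) (m + a) = 0 := by
    by_cases h' : InRange Λ (l + 1) (m + a)
    · by_cases h0 : l = -1
      · rw [coefC_eq_zero (by omega)]; simp
      · have : coefB a l m = 0 := by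
          unfold coefB
          rcases ha with rfl | rfl | rfl
          · have : (l + 1 + m) * (l + 1 - m) = 0 := by
              rcases (by unfold InRange at *; omega : l + 1 + m = 0 ∨ l + 1 - m = 0) with e | e <;>
                simp [e]
            simp [coefA_zero, this]
          · have : (l + 1 + (m + 1)) * (l + 1 + (m + 1) - 1) = 0 := by
              rcases (by unfold InRange at *; omega :
                l + 1 + (m + 1) = 0 ∨ l + 1 + (m + 1) - 1 = 0) with e | e <;> simp [e]
            rw [coefA_neg_one, this]; simp
          · have : (l + 1 - (m + -1)) * (l + 1 - (m + -1) - 1) = 0 := by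
              rcases (by unfold InRange at *; omega :
                l + 1 - (m + -1) = 0 ∨ l + 1 - (m + -1) - 1 = 0) with e | e <;> simp [e]
            rw [neg_neg, coefA_one, this]; simp
        rw [this]; simp
    · rw [psi_eq_zero h', smul_zero]
  rw [h1, h2, add_zero]

/-- The operator `ψ_l^m ↦ (-1)^l ψ_l^{-m}`, by which the rotation by `π` around the first axis
acts. -/
def flip (Λ : ℕ) : Obs Λ := opOfBasis Λ fun l m => ((-1 : ℂ) ^ l) • psi Λ l (-m)

theorem flip_psi (l m : ℤ) : flip Λ (psi Λ l m) = ((-1 : ℂ) ^ l) • psi Λ l (-m) :=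
  opOfBasis_psi fun h => by
    rw [psi_eq_zero (fun h' => h (by simpa using h'.neg)), smul_zero]

theorem neg_one_zpow_mul_self (l : ℤ) : (-1 : ℂ) ^ l * (-1 : ℂ) ^ l = 1 := by
  rw [← mul_zpow]; simp

theorem flip_mul_flip : flip Λ * flip Λ = 1 :=
  obs_ext fun l m _ => by
    simp [flip_psi, smul_smul, neg_one_zpow_mul_self]

theorem parity_mul_parity : parity Λ * parity Λ = 1 :=
  obs_ext fun l m _ => by
    simp [parity_psi, smul_smul, neg_one_zpow_mul_self]

theorem coefA_flip {a : ℤ} (ha : a = 0 ∨ a = 1 ∨ a = -1) (l m : ℤ) :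
    coefA (-a) l (-m) = (-1) ^ a * coefA a l m := by
  rcases ha with rfl | rfl | rfl
  · simp only [neg_zero, coefA_zero, zpow_zero, one_mul]
    congr 3; ring
  · simp only [coefA_neg_one, coefA_one]
    simp [sub_eq_add_neg]
  · simp only [neg_neg, coefA_neg_one, coefA_one]
    simp [sub_eq_add_neg]

theorem neg_one_zpow_sub_one (l : ℤ) : (-1 : ℂ) ^ (l - 1) = - (-1 : ℂ) ^ l := by
  rw [zpow_sub_one₀ (by simp)]; simp

theorem neg_one_zpow_add_one (l : ℤ) : (-1 : ℂ) ^ (l + 1) = - (-1 : ℂ) ^ l := by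
  rw [zpow_add_one₀ (by simp)]; simp

theorem flip_mul_xa (k : ℝ) {a : ℤ} (ha : a = 0 ∨ a = 1 ∨ a = -1) :
    flip Λ * xa Λ k a = -((-1 : ℂ) ^ a) • (xa Λ k (-a) * flip Λ) :=
  obs_ext fun l m _ => by
    have ha' : -a = 0 ∨ -a = 1 ∨ -a = -1 := by omega
    have e1 := coefA_flip ha l m
    have e2 := coefA_flip ha' (l + 1) (m + a)
    have e3 : -(m + a) = -m + -a := by ring
    have e4 : (-1 : ℝ) ^ (-a) = (-1) ^ a := by rw [_root_.zpow_neg, ← _root_.inv_zpow, inv_neg_one]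
    have e5 := neg_one_zpow_mul_self a
    rw [neg_neg, e3, e4] at e2
    simp only [mul_apply_eq_comp, _root_.smul_apply, xa_psi k ha,
      xa_psi k ha', flip_psi, map_add, map_smul, neg_one_zpow_sub_one, neg_one_zpow_add_one,
      smul_add, smul_smul, e1, e2, e3, neg_neg]
    push_cast
    congr 2
    · linear_combination (-(coefC Λ k l : ℂ) * coefA a l m * (-1) ^ l) * (-e5)
    · linear_combination
        (-(coefC Λ k (l + 1) : ℂ) * coefA (-a) (l + 1) (m + a) * (-1) ^ l) * (-e5)

theorem parity_mul_xa (k : ℝ) {a : ℤ} (ha : a = 0 ∨ a = 1 ∨ a = -1) :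
    parity Λ * xa Λ k a = -(xa Λ k a * parity Λ) :=
  obs_ext fun l m _ => by
    simp only [mul_apply_eq_comp, _root_.neg_apply, xa_psi k ha,
      parity_psi, map_add, map_smul, neg_one_zpow_sub_one, neg_one_zpow_add_one,
      smul_add, smul_smul, neg_add, ← neg_smul]
    congr 2 <;> ring

theorem flip_mul_Lplus : flip Λ * Lplus Λ = Lminus Λ * flip Λ :=
  obs_ext fun l m _ => by
    simp only [mul_apply_eq_comp, Lplus_psi, Lminus_psi, flip_psi, map_smul, smul_smul,
      neg_neg, neg_add, ← sub_eq_add_neg, mul_comm]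

/-! ### The commutators of the angular momentum with the coordinates -/

theorem sqrt_intCast_mul {p : ℤ} (hp : 0 ≤ p) (q : ℤ) :
    √((p * q : ℤ) : ℝ) = √(p : ℝ) * √(q : ℝ) := by
  rw [Int.cast_mul, Real.sqrt_mul (by exact_mod_cast hp)]

theorem mul_self_sqrt_intCast {p : ℤ} (hp : 0 ≤ p) : √(p : ℝ) * √(p : ℝ) = p :=
  Real.mul_self_sqrt (by exact_mod_cast hp)

theorem raiseCoef_eq {l m p q : ℤ} (hq : l - m = q) (hp : l + m + 1 = p) (h : 0 ≤ q ∨ 0 ≤ p) :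
    raiseCoef l m = √(p : ℝ) * √(q : ℝ) := by
  subst hp hq
  rw [raiseCoef]
  -- one nonnegative factor suffices, as the square root of a negative number is `0`
  rcases h with h | h
  · rw [sqrt_intCast_mul h, mul_comm]
  · rw [mul_comm, sqrt_intCast_mul h]

/-- The square root of the common denominator `(2l + 1)(2l - 1)` of the `A_l^{a,m}`. -/
def denom (l : ℤ) : ℝ := √(((2 * l + 1) * (2 * l - 1) : ℤ) : ℝ)

theorem denom_pos {l : ℤ} (hl : 1 ≤ l) : 0 < denom l := by
  refine Real.sqrt_pos.2 ?_
  exact_mod_cast mul_pos (by omega : 0 < 2 * l + 1) (by omega : 0 < 2 * l - 1)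

theorem sqrt_div_denom {l p : ℤ} (hl : 1 ≤ l) (hp : 0 ≤ p) (q : ℤ) :
    √(((p * q : ℤ) : ℝ) / (((2 * l + 1) * (2 * l - 1) : ℤ) : ℝ)) =
      √(p : ℝ) * √(q : ℝ) / denom l := by
  rw [Real.sqrt_div' _ (Real.sqrt_pos.1 (denom_pos hl)).le, sqrt_intCast_mul hp, denom]

theorem coefA_zero_eq {l m p q : ℤ} (hl : 1 ≤ l) (hp : l + m = p) (hq : l - m = q) (h : 0 ≤ p) :
    coefA 0 l m = √(p : ℝ) * √(q : ℝ) / denom l := by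
  subst hp hq
  rw [coefA_zero, sqrt_div_denom hl h]

theorem coefA_one_eq {l m q r : ℤ} (hl : 1 ≤ l) (hq : l - m = q) (hr : l - m - 1 = r) (h : 0 ≤ q) :
    coefA 1 l m = √(q : ℝ) * √(r : ℝ) / denom l := by
  subst hr hq
  rw [coefA_one, sqrt_div_denom hl h]

theorem coefA_neg_one_eq {l m p r : ℤ} (hl : 1 ≤ l) (hp : l + m = p) (hr : l + m - 1 = r)
    (h : 0 ≤ p) : coefA (-1) l m = -(√(p : ℝ) * √(r : ℝ) / denom l) := by
  subst hr hp
  rw [coefA_neg_one, sqrt_div_denom hl h]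

/-- The component of `[L₊, x₀] = -x₊` from level `l` to level `l - 1`. The five lemmas after it are
the component of the same relation from `l - 1` to `l`, and the two components of `[L₊, x₊] = 0` and
of `[L₊, x₋] = 2 x₀`. -/
theorem coefA_raise_zero_down {l m : ℤ} (hl : 1 ≤ l) (h1 : -l ≤ m) (h2 : m ≤ l) :
    coefA 0 l m * raiseCoef (l - 1) m - raiseCoef l m * coefA 0 l (m + 1) = -coefA 1 l m := by
  rw [coefA_zero_eq (p := l + m) (q := l - m) hl rfl rfl (by omega),
    raiseCoef_eq (p := l + m) (q := l - m - 1) (by ring) (by ring) (by omega),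
    raiseCoef_eq (p := l + m + 1) (q := l - m) rfl rfl (by omega),
    coefA_zero_eq (p := l + m + 1) (q := l - m - 1) hl (by ring) (by ring) (by omega),
    coefA_one_eq (q := l - m) (r := l - m - 1) hl rfl rfl (by omega)]
  have e1 := mul_self_sqrt_intCast (by omega : 0 ≤ l + m)
  have e2 := mul_self_sqrt_intCast (by omega : 0 ≤ l + m + 1)
  push_cast at *
  linear_combination (√((l : ℝ) - m) * √((l : ℝ) - m - 1) / denom l) * (e1 - e2)

theorem coefA_raise_zero_up {l m : ℤ} (hl : 1 ≤ l) (h1 : -l + 1 ≤ m) (h2 : m ≤ l - 1) :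
    coefA 0 l m * raiseCoef l m - raiseCoef (l - 1) m * coefA 0 l (m + 1) =
      -coefA (-1) l (m + 1) := by
  rw [coefA_zero_eq (p := l + m) (q := l - m) hl rfl rfl (by omega),
    raiseCoef_eq (l := l - 1) (p := l + m) (q := l - m - 1) (by ring) (by ring) (by omega),
    raiseCoef_eq (p := l + m + 1) (q := l - m) rfl rfl (by omega),
    coefA_zero_eq (p := l + m + 1) (q := l - m - 1) hl (by ring) (by ring) (by omega),
    coefA_neg_one_eq (p := l + m + 1) (r := l + m) hl (by ring) (by ring) (by omega)]
  have e1 := mul_self_sqrt_intCast (by omega : 0 ≤ l - m)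
  have e2 := mul_self_sqrt_intCast (by omega : 0 ≤ l - m - 1)
  push_cast at *
  linear_combination (√((l : ℝ) + m) * √((l : ℝ) + m + 1) / denom l) * (e1 - e2)

theorem coefA_raise_one_down {l m : ℤ} (hl : 1 ≤ l) (h1 : -l ≤ m) (h2 : m ≤ l) :
    coefA 1 l m * raiseCoef (l - 1) (m + 1) = raiseCoef l m * coefA 1 l (m + 1) := by
  rw [coefA_one_eq (q := l - m) (r := l - m - 1) hl rfl rfl (by omega),
    raiseCoef_eq (p := l + m + 1) (q := l - m - 2) (by ring) (by ring) (by omega),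
    raiseCoef_eq (p := l + m + 1) (q := l - m) rfl rfl (by omega)]
  rcases h2.lt_or_eq with h | rfl
  · rw [coefA_one_eq (q := l - m - 1) (r := l - m - 2) hl (by ring) (by ring) (by omega)]
    ring
  · simp

theorem coefA_raise_one_up {l m : ℤ} (hl : 1 ≤ l) (h1 : -l + 1 ≤ m) (h2 : m ≤ l - 1) :
    coefA (-1) l (m + 1) * raiseCoef l (m + 1) =
      raiseCoef (l - 1) m * coefA (-1) l (m + 1 + 1) := by
  rw [coefA_neg_one_eq (p := l + m + 1) (r := l + m) hl (by ring) (by ring) (by omega),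
    coefA_neg_one_eq (p := l + m + 2) (r := l + m + 1) hl (by ring) (by ring) (by omega),
    raiseCoef_eq (l := l - 1) (p := l + m) (q := l - m - 1) (by ring) (by ring) (by omega),
    raiseCoef_eq (p := l + m + 2) (q := l - m - 1) (by ring) (by ring) (by omega)]
  ring

theorem coefA_raise_neg_one_down {l m : ℤ} (hl : 1 ≤ l) (h1 : -l ≤ m) (h2 : m ≤ l) :
    coefA (-1) l m * raiseCoef (l - 1) (m - 1) - raiseCoef l m * coefA (-1) l (m + 1) =
      2 * coefA 0 l m := by
  rw [coefA_neg_one_eq (p := l + m) (r := l + m - 1) hl rfl rfl (by omega),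
    coefA_neg_one_eq (p := l + m + 1) (r := l + m) hl (by ring) (by ring) (by omega),
    raiseCoef_eq (p := l + m - 1) (q := l - m) (by ring) (by ring) (by omega),
    raiseCoef_eq (p := l + m + 1) (q := l - m) rfl rfl (by omega),
    coefA_zero_eq (p := l + m) (q := l - m) hl rfl rfl (by omega)]
  have e1 : √((l + m : ℤ) : ℝ) * (√((l + m - 1 : ℤ) : ℝ) * √((l + m - 1 : ℤ) : ℝ)) =
      √((l + m : ℤ) : ℝ) * (l + m - 1 : ℤ) := by
    rcases h1.lt_or_eq with h | rfl
    · rw [mul_self_sqrt_intCast (by omega)]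
    · simp
  have e2 := mul_self_sqrt_intCast (by omega : 0 ≤ l + m + 1)
  push_cast at *
  linear_combination (√((l : ℝ) - m) / denom l) * (√((l : ℝ) + m) * e2 - e1)

theorem coefA_raise_neg_one_up {l m : ℤ} (hl : 1 ≤ l) (h1 : -l + 1 ≤ m) (h2 : m ≤ l - 1) :
    coefA 1 l (m - 1) * raiseCoef l (m - 1) - raiseCoef (l - 1) m * coefA 1 l m =
      2 * coefA 0 l m := by
  rw [coefA_one_eq (q := l - m + 1) (r := l - m) hl (by ring) (by ring) (by omega),
    coefA_one_eq (q := l - m) (r := l - m - 1) hl (by ring) (by ring) (by omega),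
    raiseCoef_eq (l := l - 1) (p := l + m) (q := l - m - 1) (by ring) (by ring) (by omega),
    raiseCoef_eq (p := l + m) (q := l - m + 1) (by ring) (by ring) (by omega),
    coefA_zero_eq (p := l + m) (q := l - m) hl rfl rfl (by omega)]
  have e1 := mul_self_sqrt_intCast (by omega : 0 ≤ l - m + 1)
  have e2 := mul_self_sqrt_intCast (by omega : 0 ≤ l - m - 1)
  push_cast at *
  linear_combination (√((l : ℝ) + m) * √((l : ℝ) - m) / denom l) * (e1 - e2)

/-- A commutator of the raising operator with a coordinate, from the corresponding identities of the
coefficients for the transitions `l → l - 1` and `l → l + 1`. -/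
theorem Lplus_comm_xa {k : ℝ} {a b : ℤ} (r : ℝ) (ha : a = 0 ∨ a = 1 ∨ a = -1)
    (hb : b = 0 ∨ b = 1 ∨ b = -1) (hab : r = 0 ∨ b = a + 1)
    (hd : ∀ l m : ℤ, 1 ≤ l → -l ≤ m → m ≤ l →
      coefA a l m * raiseCoef (l - 1) (m + a) - raiseCoef l m * coefA a l (m + 1) =
        r * coefA b l m)
    (hu : ∀ l m : ℤ, 1 ≤ l → -l + 1 ≤ m → m ≤ l - 1 →
      coefA (-a) l (m + a) * raiseCoef l (m + a) -
        raiseCoef (l - 1) m * coefA (-a) l (m + 1 + a) = r * coefA (-b) l (m + b)) :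
    Lplus Λ * xa Λ k a - xa Λ k a * Lplus Λ = (r : ℂ) • xa Λ k b :=
  obs_ext fun l m h => by
    have hd' : coefC Λ k l * (coefA a l m * raiseCoef (l - 1) (m + a) -
        raiseCoef l m * coefA a l (m + 1)) = coefC Λ k l * (r * coefA b l m) := by
      by_cases hl : 1 ≤ l
      · rw [hd l m hl h.2.2.1 h.2.2.2]
      · rw [coefC_eq_zero (by omega)]; simp
    have hu' := hu (l + 1) m (by linarith [h.1]) (by linarith [h.2.2.1]) (by linarith [h.2.2.2])
    rw [add_sub_cancel_right] at hu'
    replace hd' := congrArg ((↑) : ℝ → ℂ) hd'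
    replace hu' := congrArg ((↑) : ℝ → ℂ) hu'
    push_cast at hd' hu'
    have e : m + 1 + a = m + a + 1 := by ring
    rw [e] at hu'
    simp only [_root_.sub_apply, mul_apply_eq_comp, _root_.smul_apply, xa_psi k ha,
      xa_psi k hb, Lplus_psi, map_add, map_smul, smul_add, smul_smul, e]
    rw [add_sub_add_comm, ← sub_smul, ← sub_smul]
    push_cast
    rcases hab with rfl | rfl
    -- for `r = 0` the labels `m + a + 1` and `m + b` may differ, but both sides vanish
    · simp only [Complex.ofReal_zero, zero_mul, mul_zero, zero_smul] at hd' hu' ⊢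
      rw [add_zero, add_eq_zero_iff_eq_neg, ← neg_smul]
      convert (zero_smul ℂ (psi Λ (l - 1) (m + a + 1))).trans
        (zero_smul ℂ (psi Λ (l + 1) (m + a + 1))).symm using 2
      · linear_combination hd'
      · linear_combination (-coefC Λ k (l + 1) : ℂ) * hu'
    · rw [← add_assoc] at hu' ⊢
      congr 2
      · linear_combination hd'
      · linear_combination (coefC Λ k (l + 1) : ℂ) * hu'

theorem Lplus_comm_x0 (k : ℝ) :
    Lplus Λ * xa Λ k 0 - xa Λ k 0 * Lplus Λ = -xa Λ k 1 := by
  rw [Lplus_comm_xa (a := 0) (b := 1) (-1) (by simp) (by simp) (by simp)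
    (fun l m hl h1 h2 => by simpa using coefA_raise_zero_down hl h1 h2)
    (fun l m hl h1 h2 => by simpa using coefA_raise_zero_up hl h1 h2), Complex.ofReal_neg,
    Complex.ofReal_one]
  exact neg_one_smul ℂ (_ : Obs Λ)

theorem Lplus_comm_x1 (k : ℝ) :
    Lplus Λ * xa Λ k 1 - xa Λ k 1 * Lplus Λ = 0 := by
  rw [Lplus_comm_xa (a := 1) (b := 0) 0 (by simp) (by simp) (by simp)
    (fun l m hl h1 h2 => by simpa [sub_eq_zero] using coefA_raise_one_down hl h1 h2)
    (fun l m hl h1 h2 => by simpa [sub_eq_zero] using coefA_raise_one_up hl h1 h2),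
    Complex.ofReal_zero]
  exact zero_smul ℂ (_ : Obs Λ)

theorem Lplus_comm_xneg (k : ℝ) :
    Lplus Λ * xa Λ k (-1) - xa Λ k (-1) * Lplus Λ = (2 : ℂ) • xa Λ k 0 := by
  simpa using Lplus_comm_xa (Λ := Λ) (k := k) (a := -1) (b := 0) 2 (by simp) (by simp) (by simp)
    (fun l m hl h1 h2 => by
      simpa [← sub_eq_add_neg] using coefA_raise_neg_one_down hl h1 h2)
    (fun l m hl h1 h2 => by
      simpa [← sub_eq_add_neg] using coefA_raise_neg_one_up hl h1 h2)

theorem Lminus_eq_flip : Lminus Λ = flip Λ * Lplus Λ * flip Λ := by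
  rw [flip_mul_Lplus, mul_assoc, flip_mul_flip, mul_one]

theorem flip_conj_xa (k : ℝ) {a : ℤ} (ha : a = 0 ∨ a = 1 ∨ a = -1) :
    flip Λ * xa Λ k a * flip Λ = -((-1 : ℂ) ^ a) • xa Λ k (-a) := by
  rw [flip_mul_xa k ha, smul_mul_assoc, mul_assoc, flip_mul_flip, mul_one]

theorem flip_conj_x0 (k : ℝ) : flip Λ * xa Λ k 0 * flip Λ = -xa Λ k 0 := by
  rw [flip_conj_xa k (by simp), zpow_zero]
  exact neg_one_smul ℂ (_ : Obs Λ)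

theorem flip_conj_x1 (k : ℝ) : flip Λ * xa Λ k 1 * flip Λ = xa Λ k (-1) := by
  simpa using flip_conj_xa (Λ := Λ) k (a := 1) (by simp)

theorem flip_conj_xneg (k : ℝ) : flip Λ * xa Λ k (-1) * flip Λ = xa Λ k 1 := by
  simpa using flip_conj_xa (Λ := Λ) k (a := -1) (by simp)

/-- The matrix `I₂`, the generator of `rot2`. -/
def gen2 : Matrix (Fin 3) (Fin 3) ℝ := !![0, 0, -1; 0, 0, 0; 1, 0, 0]

/-- The matrix `I₃`, the generator of `rot3`. -/
def gen3 : Matrix (Fin 3) (Fin 3) ℝ := !![0, 1, 0; -1, 0, 0; 0, 0, 0]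

/-- The linear combination `∑ⱼ Mᵢⱼ Xⱼ` of a triple `X`. -/
def lin {A : Type*} [AddCommGroup A] [Module ℂ A] (X : Fin 3 → A) (M : Matrix (Fin 3) (Fin 3) ℝ)
    (i : Fin 3) : A := ∑ j, ((M i j : ℝ) : ℂ) • X j

section lin

variable {A : Type*} [Ring A] [Algebra ℂ A] {X : Fin 3 → A}

theorem lin_lin (M N : Matrix (Fin 3) (Fin 3) ℝ) (i : Fin 3) :
    lin (lin X N) M i = lin X (M * N) i := by
  simp only [lin, Finset.smul_sum, smul_smul, Matrix.mul_apply, Complex.ofReal_sum,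
    Complex.ofReal_mul, Finset.sum_smul]
  exact Finset.sum_comm

theorem lin_one (i : Fin 3) : lin X 1 i = X i := by
  simp [lin, Matrix.one_apply, ite_smul]

theorem conj_lin (U V : A) (M : Matrix (Fin 3) (Fin 3) ℝ) (i : Fin 3) :
    V * lin X M i * U = lin (fun j => V * X j * U) M i := by
  simp only [lin, Finset.mul_sum, Finset.sum_mul, mul_smul_comm, smul_mul_assoc]

theorem comm_lin {L : A} {N : Matrix (Fin 3) (Fin 3) ℝ}
    (h : ∀ j, L * X j - X j * L = -lin X N j) (M : Matrix (Fin 3) (Fin 3) ℝ) (i : Fin 3) :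
    L * lin X M i - lin X M i * L = -lin X (M * N) i := by
  rw [← lin_lin, lin, lin, Finset.mul_sum, Finset.sum_mul, ← Finset.sum_sub_distrib,
    ← Finset.sum_neg_distrib]
  refine Finset.sum_congr rfl fun j _ => ?_
  rw [mul_smul_comm, smul_mul_assoc, ← smul_sub, h, smul_neg]

theorem lin_gen2 (X : Fin 3 → A) :
    lin X gen2 0 = -X 2 ∧ lin X gen2 1 = 0 ∧ lin X gen2 2 = X 0 := by
  simp [lin, gen2, Fin.sum_univ_three]

theorem lin_gen3 (X : Fin 3 → A) :
    lin X gen3 0 = X 1 ∧ lin X gen3 1 = -X 0 ∧ lin X gen3 2 = 0 := by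
  simp [lin, gen3, Fin.sum_univ_three]

end lin

/-- If `J` is an involution that exchanges `x₊` and `x₋` and reverses `x₀`, the commutators of the
lowering operator `J L₊ J` with the coordinates follow from those of the raising operator, and
`i L₂ = (L₊ - J L₊ J) / 2` generates the rotation around the second axis. -/
theorem comm_coordinates_of_involution {A : Type*} [Ring A] [Algebra ℂ A] {J P X₀ X₁ X₂ : A}
    {X : Fin 3 → A} (x₀ : X 0 = (1 / 2 : ℂ) • (X₁ + X₂))
    (x₁ : X 1 = (1 / (2 * Complex.I)) • (X₁ - X₂)) (x₂ : X 2 = X₀)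
    (hJ : J * J = 1) (j₀ : J * X₀ * J = -X₀) (j₁ : J * X₁ * J = X₂) (j₂ : J * X₂ * J = X₁)
    (h₀ : P * X₀ - X₀ * P = -X₁) (h₁ : P * X₁ - X₁ * P = 0)
    (h₂ : P * X₂ - X₂ * P = (2 : ℂ) • X₀) {L : A} (hL : L = (1 / 2 : ℂ) • (P - J * P * J))
    (j : Fin 3) : L * X j - X j * L = -lin X gen2 j := by
  have e : ∀ X : A, J * (P * X - X * P) * J =
      J * P * J * (J * X * J) - J * X * J * (J * P * J) := fun X => by
    calc _ = J * P * 1 * X * J - J * X * 1 * P * J := by noncomm_ring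
      _ = _ := by rw [← hJ]; noncomm_ring
  have g₀ := e X₀
  have g₁ := e X₂
  have g₂ := e X₁
  rw [h₀, j₀, mul_neg, neg_mul, j₁] at g₀
  rw [h₂, j₂, mul_smul_comm, smul_mul_assoc, j₀] at g₁
  rw [h₁, j₁, mul_zero, zero_mul] at g₂
  generalize J * P * J = M at *
  have f : ∀ X : A, L * X - X * L = (1 / 2 : ℂ) • ((P * X - X * P) - (M * X - X * M)) :=
    fun X => by
      rw [hL, mul_smul_comm, smul_mul_assoc, ← smul_sub]
      noncomm_ring
  have f₀ : L * X₀ - X₀ * L = -((1 / 2 : ℂ) • (X₁ + X₂)) := by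
    have : M * X₀ - X₀ * M = X₂ := by
      rw [← neg_neg X₂, g₀]; noncomm_ring
    rw [f, h₀, this]
    module
  have f₁ : L * X₁ - X₁ * L = X₀ := by
    rw [f, h₁, ← g₁]; module
  have f₂ : L * X₂ - X₂ * L = X₀ := by
    rw [f, h₂, ← g₂]; module
  obtain ⟨l₀, l₁, l₂⟩ := lin_gen2 X
  match j with
  | 0 =>
    rw [l₀, x₀, x₂, neg_neg]
    calc _ = (1 / 2 : ℂ) • ((L * X₁ - X₁ * L) + (L * X₂ - X₂ * L)) := by
          rw [mul_smul_comm, smul_mul_assoc, ← smul_sub]; noncomm_ring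
      _ = _ := by rw [f₁, f₂]; module
  | 1 =>
    rw [l₁, x₁, neg_zero]
    calc _ = (1 / (2 * Complex.I)) • ((L * X₁ - X₁ * L) - (L * X₂ - X₂ * L)) := by
          rw [mul_smul_comm, smul_mul_assoc, ← smul_sub]; congr 1; noncomm_ring
      _ = _ := by rw [f₁, f₂]; module
  | 2 => rw [l₂, x₂, x₀, f₀]

/-- If `x₊`, `x₋`, `x₀` have the weights `1`, `-1`, `0` for `L`, then `i L` generates the rotation
around the third axis. -/
theorem comm_coordinates_of_weights {A : Type*} [Ring A] [Algebra ℂ A] {L X₀ X₁ X₂ : A}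
    {X : Fin 3 → A} (x₀ : X 0 = (1 / 2 : ℂ) • (X₁ + X₂))
    (x₁ : X 1 = (1 / (2 * Complex.I)) • (X₁ - X₂)) (x₂ : X 2 = X₀)
    (h₀ : L * X₀ - X₀ * L = (0 : ℂ) • X₀) (h₁ : L * X₁ - X₁ * L = (1 : ℂ) • X₁)
    (h₂ : L * X₂ - X₂ * L = (-1 : ℂ) • X₂) (j : Fin 3) :
    Complex.I • L * X j - X j * Complex.I • L = -lin X gen3 j := by
  have hI : 1 / (2 * Complex.I) = -(Complex.I / 2) := by
    field_simp; simp
  have hII := Complex.I_mul_I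
  obtain ⟨l₀, l₁, l₂⟩ := lin_gen3 X
  match j with
  | 0 =>
    rw [l₀, x₀, x₁]
    calc _ = (Complex.I / 2) • ((L * X₁ - X₁ * L) + (L * X₂ - X₂ * L)) := by
          simp only [mul_smul_comm, smul_mul_assoc, mul_add, add_mul]; module
      _ = _ := by rw [h₁, h₂, hI]; module
  | 1 =>
    rw [l₁, x₀, x₁]
    calc _ = (-(Complex.I * Complex.I) / 2) • ((L * X₁ - X₁ * L) - (L * X₂ - X₂ * L)) := by
          rw [hI]
          simp only [mul_smul_comm, smul_mul_assoc, mul_sub, sub_mul]; module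
      _ = _ := by rw [h₁, h₂, hII]; module
  | 2 => rw [l₂, x₂, mul_smul_comm, smul_mul_assoc, ← smul_sub, h₀, zero_smul, smul_zero, neg_zero]

theorem L3_comm_xa (k : ℝ) {a : ℤ} (ha : a = 0 ∨ a = 1 ∨ a = -1) :
    L3 Λ * xa Λ k a - xa Λ k a * L3 Λ = (a : ℂ) • xa Λ k a :=
  obs_ext fun l m _ => by
    simp only [_root_.sub_apply, mul_apply_eq_comp, _root_.smul_apply, xa_psi k ha,
      L3_psi, map_add, map_smul, smul_add, smul_smul]
    rw [add_sub_add_comm, ← sub_smul, ← sub_smul]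
    push_cast
    congr 2 <;> ring

theorem I_smul_L2 :
    Complex.I • L2 Λ = (1 / 2 : ℂ) • (Lplus Λ - flip Λ * Lplus Λ * flip Λ) := by
  rw [← Lminus_eq_flip, L2, smul_smul]
  congr 1
  field_simp

theorem L2_comm_x (k : ℝ) (j : Fin 3) :
    Complex.I • L2 Λ * x Λ k j - x Λ k j * Complex.I • L2 Λ = -lin (x Λ k) gen2 j :=
  comm_coordinates_of_involution (X := x Λ k) rfl rfl rfl (flip_mul_flip (Λ := Λ)) (flip_conj_x0 k)
    (flip_conj_x1 k) (flip_conj_xneg k) (Lplus_comm_x0 k) (Lplus_comm_x1 k) (Lplus_comm_xneg k)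
    I_smul_L2 j

theorem L3_comm_x (k : ℝ) (j : Fin 3) :
    Complex.I • L3 Λ * x Λ k j - x Λ k j * Complex.I • L3 Λ = -lin (x Λ k) gen3 j := by
  have h₀ := L3_comm_xa (Λ := Λ) k (a := 0) (by simp)
  have h₁ := L3_comm_xa (Λ := Λ) k (a := 1) (by simp)
  have h₂ := L3_comm_xa (Λ := Λ) k (a := -1) (by simp)
  rw [Int.cast_zero] at h₀
  rw [Int.cast_one] at h₁
  rw [Int.cast_neg, Int.cast_one] at h₂
  exact comm_coordinates_of_weights (X := x Λ k) rfl rfl rfl h₀ h₁ h₂ j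

/-! ### The vacuum is cyclic for the coordinates -/

section cyclic

variable {k : ℝ} {E : Submodule ℂ (Hilb Λ)}

theorem psi_self_mem (hk : 0 < k)
    (hE : ∀ a : ℤ, a = 0 ∨ a = 1 ∨ a = -1 → ∀ v ∈ E, xa Λ k a v ∈ E) (h0 : psi Λ 0 0 ∈ E) (n : ℕ) :
    psi Λ n n ∈ E := by
  induction n with
  | zero => exact h0
  | succ n ih =>
    by_cases hn : ((n : ℤ) + 1) ≤ Λ
    · have h := hE 1 (by simp) _ ih
      have e1 : coefA 1 n n = 0 := by rw [coefA_one]; simp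
      have e2 : coefA (-1) ((n : ℤ) + 1) (n + 1) ≠ 0 := by
        rw [coefA_neg_one_eq (by omega) rfl rfl (by omega), neg_ne_zero]
        refine (div_pos (mul_pos ?_ ?_) (denom_pos (by omega))).ne' <;>
        exact Real.sqrt_pos.2 (Int.cast_pos.2 (by omega))
      have e3 := (coefC_pos (Λ := Λ) hk (l := (n : ℤ) + 1) ⟨by omega, hn⟩).ne'
      rw [xa_psi k (by simp), e1, mul_zero, Complex.ofReal_zero, zero_smul, zero_add] at h
      push_cast
      exact (E.smul_mem_iff (by exact_mod_cast mul_ne_zero e3 e2)).1 h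
    · rw [psi_eq_zero (by unfold InRange; push_cast; omega)]
      exact E.zero_mem

/-- Induction on `n = l - m` by means of `x₀`, which relates three consecutive levels; for this
reason the statement concerns two of them. For `n = 0` the second vector is `0`. -/
theorem psi_mem_of_nonneg (hk : 0 < k)
    (hE : ∀ a : ℤ, a = 0 ∨ a = 1 ∨ a = -1 → ∀ v ∈ E, xa Λ k a v ∈ E) (h0 : psi Λ 0 0 ∈ E)
    (m n : ℕ) : psi Λ (m + n) m ∈ E ∧ psi Λ (m + n - 1) m ∈ E := by
  induction n with
  | zero =>
    refine ⟨by simpa using psi_self_mem hk hE h0 m, ?_⟩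
    rw [psi_eq_zero (by unfold InRange; push_cast; omega)]
    exact E.zero_mem
  | succ n ih =>
    have e : (m : ℤ) + ((n + 1 : ℕ) : ℤ) = m + n + 1 := by push_cast; ring
    rw [e, add_sub_cancel_right]
    refine ⟨?_, ih.1⟩
    by_cases hn : (m : ℤ) + n + 1 ≤ Λ
    · have h := hE 0 (by simp) _ ih.1
      rw [xa_psi k (by simp), E.add_mem_iff_right (E.smul_mem _ (by simpa using ih.2)), neg_zero,
        add_zero] at h
      have e2 : coefA 0 ((m : ℤ) + n + 1) m ≠ 0 := by
        rw [coefA_zero_eq (by omega) rfl rfl (by omega)]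
        refine (div_pos (mul_pos ?_ ?_) (denom_pos (by omega))).ne' <;>
        exact Real.sqrt_pos.2 (Int.cast_pos.2 (by omega))
      have e3 := (coefC_pos (Λ := Λ) hk (l := (m : ℤ) + n + 1) ⟨by omega, hn⟩).ne'
      exact (E.smul_mem_iff (by exact_mod_cast mul_ne_zero e3 e2)).1 h
    · rw [psi_eq_zero (by unfold InRange; omega)]
      exact E.zero_mem

/-- The coordinates `x_a` produce every basis vector from `ψ_0^0`: powers of `x₊` lead to `ψ_m^m`,
then `x₀` raises `l`; negative `m` are reached through the flip. -/
theorem psi_mem_of_invariant (hk : 0 < k)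
    (hE : ∀ a : ℤ, a = 0 ∨ a = 1 ∨ a = -1 → ∀ v ∈ E, xa Λ k a v ∈ E) (h0 : psi Λ 0 0 ∈ E)
    {l m : ℤ} (h : InRange Λ l m) : psi Λ l m ∈ E := by
  rcases le_total 0 m with hm | hm
  · obtain ⟨m', rfl⟩ := Int.eq_ofNat_of_zero_le hm
    obtain ⟨n, hn⟩ := Int.eq_ofNat_of_zero_le (sub_nonneg.2 h.2.2.2)
    have := (psi_mem_of_nonneg hk hE h0 m' n).1
    rwa [← Int.ofNat_eq_natCast n, ← Int.ofNat_eq_natCast m', Int.ofNat_eq_natCast n, ← hn,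
      Int.ofNat_eq_natCast m', add_sub_cancel] at this
  · obtain ⟨m', hm'⟩ := Int.eq_ofNat_of_zero_le (neg_nonneg.2 hm)
    obtain ⟨n, hn⟩ := Int.eq_ofNat_of_zero_le (by linarith [h.2.2.1] : 0 ≤ l - -m)
    have key := (psi_mem_of_nonneg (E := E.comap (flip Λ).toLinearMap) hk (fun a ha v hv => by
      have hf := congrArg (fun S : Obs Λ => S v) (flip_mul_xa (Λ := Λ) k ha)
      simp only [mul_apply_eq_comp, _root_.smul_apply] at hf
      rw [Submodule.mem_comap, ContinuousLinearMap.coe_coe, hf]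
      exact E.smul_mem _ (hE (-a) (by omega) _ hv)) (by
        rw [Submodule.mem_comap, ContinuousLinearMap.coe_coe, flip_psi]
        simpa using h0) m' n).1
    have e1 : (m' : ℤ) = -m := hm'.symm
    have e2 : (n : ℤ) = l - -m := hn.symm
    rw [Submodule.mem_comap, ContinuousLinearMap.coe_coe, flip_psi, e1, e2, neg_neg,
      E.smul_mem_iff (zpow_ne_zero _ (by simp)), add_sub_cancel] at key
    exact key

end cyclic

theorem xa_one_eq (k : ℝ) : xa Λ k 1 = x Λ k 0 + Complex.I • x Λ k 1 := by
  have : ∀ {A : Type} [AddCommGroup A] [Module ℂ A] (X Y : A),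
      X = (1 / 2 : ℂ) • (X + Y) + Complex.I • (1 / (2 * Complex.I)) • (X - Y) := fun X Y => by
    rw [smul_smul, show Complex.I * (1 / (2 * Complex.I)) = 1 / 2 by field_simp]
    module
  exact this _ _

theorem xa_neg_one_eq (k : ℝ) : xa Λ k (-1) = x Λ k 0 - Complex.I • x Λ k 1 := by
  have : ∀ {A : Type} [AddCommGroup A] [Module ℂ A] (X Y : A),
      Y = (1 / 2 : ℂ) • (X + Y) - Complex.I • (1 / (2 * Complex.I)) • (X - Y) := fun X Y => by
    rw [smul_smul, show Complex.I * (1 / (2 * Complex.I)) = 1 / 2 by field_simp]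
    module
  exact this _ _

/-- An operator that commutes with the coordinates and fixes `ψ_0^0` is the identity. -/
theorem eq_one_of_commute_x {k : ℝ} (hk : 0 < k) {W : Obs Λ} (hW : ∀ i, Commute W (x Λ k i))
    (h0 : W (psi Λ 0 0) = psi Λ 0 0) : W = 1 := by
  have hc : ∀ a : ℤ, a = 0 ∨ a = 1 ∨ a = -1 → Commute W (xa Λ k a) := by
    rintro a (rfl | rfl | rfl)
    · exact hW 2
    · rw [xa_one_eq]
      exact (hW 0).add_right ((hW 1).smul_right _)
    · rw [xa_neg_one_eq]
      exact (hW 0).sub_right ((hW 1).smul_right _)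
  refine obs_ext fun l m h => ?_
  refine psi_mem_of_invariant (E := LinearMap.eqLocus W.toLinearMap (1 : Obs Λ).toLinearMap) hk
    (fun a ha v hv => ?_) h0 h
  have h1 : W v = v := hv
  change W (xa Λ k a v) = xa Λ k a v
  have := congrArg (fun S : Obs Λ => S v) (hc a ha).eq
  simp only [mul_apply_eq_comp, h1] at this
  exact this

/-! ### Operators that implement a rotation -/

/-- The operator `U` implements `g`: it is unitary, fixes `ψ_0^0`, and
`U⁻¹ xᵢ U = ∑ⱼ gᵢⱼ xⱼ`. -/
structure Implements (k : ℝ) (U : Obs Λ) (g : Matrix (Fin 3) (Fin 3) ℝ) : Prop where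
  mem_unitary : U ∈ unitary (Obs Λ)
  vacuum : U (psi Λ 0 0) = psi Λ 0 0
  conj : ∀ i, star U * x Λ k i * U = lin (x Λ k) g i

namespace Implements

variable {k : ℝ} {U V : Obs Λ} {g h : Matrix (Fin 3) (Fin 3) ℝ}

theorem mul (hU : Implements k U g) (hV : Implements k V h) : Implements k (U * V) (g * h) where
  mem_unitary := mul_mem hU.mem_unitary hV.mem_unitary
  vacuum := by rw [mul_apply_eq_comp, hV.vacuum, hU.vacuum]
  conj i := by
    calc star (U * V) * x Λ k i * (U * V) = star V * (star U * x Λ k i * U) * V := by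
          rw [star_mul]; simp only [mul_assoc]
      _ = lin (x Λ k) (g * h) i := by
          rw [hU.conj, conj_lin, ← lin_lin]
          simp only [hV.conj]

/-- An operator that implements `g` is determined by `g`. -/
theorem unique (hk : 0 < k) (hU : Implements k U g) (hV : Implements k V g) : U = V := by
  obtain ⟨u1, u2⟩ := Unitary.mem_iff.1 hU.mem_unitary
  obtain ⟨v1, v2⟩ := Unitary.mem_iff.1 hV.mem_unitary
  have key : U * star V = 1 := by
    refine eq_one_of_commute_x hk (fun i => ?_) ?_
    · have := (hU.conj i).trans (hV.conj i).symm
      calc U * star V * x Λ k i = U * (star V * x Λ k i * V) * star V := by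
            rw [mul_assoc, mul_assoc, mul_assoc (star V * x Λ k i), v2, mul_one]
        _ = x Λ k i * (U * star V) := by
            rw [← this]
            calc _ = (U * star U) * x Λ k i * (U * star V) := by simp only [mul_assoc]
              _ = _ := by rw [u2, one_mul]
    · have := congrArg (fun S : Obs Λ => S (psi Λ 0 0)) v1
      simp only [mul_apply_eq_comp, hV.vacuum] at this
      rw [mul_apply_eq_comp, this]
      exact hU.vacuum
  calc U = U * (star V * V) := by rw [v1, mul_one]
    _ = V := by rw [← mul_assoc, key, one_mul]

end Implements

/-! ### The exponentials of the angular momentum -/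

theorem obs_ext_inner {S T : Obs Λ} (h : ∀ l m l' m', InRange Λ l m → InRange Λ l' m' →
    inner ℂ (psi Λ l m) (S (psi Λ l' m')) = inner ℂ (psi Λ l m) (T (psi Λ l' m'))) : S = T :=
  obs_ext fun l' m' h' => by
    ext p
    have := h p.1 p.2 l' m' (inRange_coe p) h'
    rwa [inner_psi_left (inRange_coe p) _ p rfl rfl, inner_psi_left (inRange_coe p) _ p rfl rfl]
      at this

theorem inner_psi_psi_of_right {l' m' : ℤ} (h : InRange Λ l' m') (l m : ℤ) :
    inner ℂ (psi Λ l m) (psi Λ l' m') = if l = l' ∧ m = m' then 1 else 0 := by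
  rw [← inner_conj_symm, inner_psi_psi h, apply_ite (starRingEnd ℂ), map_one, map_zero]
  exact if_congr (by rw [eq_comm, @eq_comm _ m']) rfl rfl

theorem star_Lplus : star (Lplus Λ) = Lminus Λ :=
  obs_ext_inner fun l m l' m' h h' => by
    rw [ContinuousLinearMap.star_eq_adjoint, ContinuousLinearMap.adjoint_inner_right, Lplus_psi,
      Lminus_psi, inner_smul_left, inner_smul_right, inner_psi_psi h, inner_psi_psi_of_right h',
      Complex.conj_ofReal]
    by_cases e : l = l' ∧ m + 1 = m'
    · obtain ⟨rfl, rfl⟩ := e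
      have : raiseCoef l (-(m + 1)) = raiseCoef l m := by
        unfold raiseCoef; congr 2; ring
      rw [this]; simp
    · rw [if_neg e, if_neg (by omega)]; simp

theorem star_L3 : star (L3 Λ) = L3 Λ :=
  obs_ext_inner fun l m l' m' h h' => by
    rw [ContinuousLinearMap.star_eq_adjoint, ContinuousLinearMap.adjoint_inner_right, L3_psi,
      L3_psi, inner_smul_left, inner_smul_right, inner_psi_psi h]
    by_cases e : l = l' ∧ m = m'
    · obtain ⟨rfl, rfl⟩ := e
      simp
    · rw [if_neg e]; simp

theorem star_L2 : star (L2 Λ) = L2 Λ := by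
  have key : ∀ {A : Type} [Ring A] [StarRing A] [Algebra ℂ A] [StarModule ℂ A] {P M : A},
      star P = M → star ((1 / (2 * Complex.I)) • (P - M)) = (1 / (2 * Complex.I)) • (P - M) := by
    intro A _ _ _ _ P M h
    have h' : star M = P := by rw [← h, star_star]
    rw [star_smul, star_sub, h, h']
    have : star (1 / (2 * Complex.I)) = -(1 / (2 * Complex.I)) := by simp
    rw [this, neg_smul, ← smul_neg, neg_sub]
  exact key star_Lplus

/-- If `[L, Xⱼ] = -∑ N_{jk} X_k`, then conjugation with `exp (t L)` acts on the triple `X` by the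
solution `r` of `r' = r N`, `r 0 = 1`. -/
theorem exp_conj_eq_lin {A : Type*} [NormedRing A] [NormedAlgebra ℂ A] [CompleteSpace A]
    {L : A} {X : Fin 3 → A} {N : Matrix (Fin 3) (Fin 3) ℝ} {r : ℝ → Matrix (Fin 3) (Fin 3) ℝ}
    (h : ∀ j, L * X j - X j * L = -lin X N j) (r0 : r 0 = 1)
    (hr : ∀ t i j, HasDerivAt (fun s => r s i j) ((r t * N) i j) t) (t : ℝ) (i : Fin 3) :
    X i * NormedSpace.exp (t • L) = NormedSpace.exp (t • L) * lin X (r t) i := by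
  have hlin : ∀ t, HasDerivAt (fun s => lin X (r s) i) (lin X (r t * N) i) t := fun t => by
    unfold lin
    exact HasDerivAt.fun_sum fun j _ => (hr t i j).ofReal_comp.smul_const (X j)
  -- this function is constant in `t` by the differential equation
  have hF : ∀ t, HasDerivAt
      (fun s : ℝ => NormedSpace.exp (s • L) * lin X (r s) i * NormedSpace.exp (s • (-L))) 0 t := by
    intro t
    refine (((hasDerivAt_exp_smul_const (𝕂 := ℝ) L t).fun_mul (hlin t)).fun_mul
      (hasDerivAt_exp_smul_const' (𝕂 := ℝ) (-L) t)).congr_deriv (Eq.symm ?_)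
    have := comm_lin h (r t) i
    calc (0 : A) = NormedSpace.exp (t • L) * ((L * lin X (r t) i - lin X (r t) i * L) +
          lin X (r t * N) i) * NormedSpace.exp (t • (-L)) := by rw [this]; simp
      _ = _ := by noncomm_ring
  have hconst := is_const_of_deriv_eq_zero (fun t => (hF t).differentiableAt)
    (fun t => (hF t).deriv) t 0
  have hinv : NormedSpace.exp (t • (-L)) * NormedSpace.exp (t • L) = 1 := by
    rw [smul_neg]
    let : NormedAlgebra ℚ A := NormedAlgebra.restrictScalars ℚ ℝ A
    rw [← NormedSpace.exp_add_of_commute (Commute.refl _).neg_left, neg_add_cancel,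
      NormedSpace.exp_zero]
  simp only [zero_smul, NormedSpace.exp_zero, one_mul, mul_one, r0, lin_one] at hconst
  rw [← hconst, mul_assoc, hinv, mul_one]

theorem exp_apply_eq_self {B : Obs Λ} {v : Hilb Λ} (h : B v = 0) : NormedSpace.exp B v = v := by
  have hs := (NormedSpace.exp_series_hasSum_exp' (𝕂 := ℂ) B).mapL
    (ContinuousLinearMap.apply ℂ (Hilb Λ) v)
  refine hs.unique ?_
  convert hasSum_single 0 fun n hn => ?_ using 1
  · simp
  · obtain ⟨n, rfl⟩ := Nat.exists_eq_succ_of_ne_zero hn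
    simp [pow_succ, h]

/-- If `L` is self-adjoint, annihilates `ψ_0^0`, and `i L` acts on the coordinates by the generator
`N`, then `exp (i t L)` implements the solution `r t` of `r' = r N`, `r 0 = 1`. -/
theorem implements_exp {k : ℝ} {L : Obs Λ} (hL : star L = L) (h0 : L (psi Λ 0 0) = 0)
    {N : Matrix (Fin 3) (Fin 3) ℝ} {r : ℝ → Matrix (Fin 3) (Fin 3) ℝ}
    (h : ∀ j, Complex.I • L * x Λ k j - x Λ k j * Complex.I • L = -lin (x Λ k) N j) (r0 : r 0 = 1)
    (hr : ∀ t i j, HasDerivAt (fun s => r s i j) ((r t * N) i j) t) (t : ℝ) :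
    Implements k (NormedSpace.exp ((Complex.I * (t : ℂ)) • L)) (r t) := by
  have hu : NormedSpace.exp ((Complex.I * (t : ℂ)) • L) ∈ unitary (Obs Λ) := by
    have : IsSelfAdjoint ((t : ℂ) • L) := by
      rw [IsSelfAdjoint, star_smul, hL]; simp
    rw [mul_smul]
    exact (selfAdjoint.expUnitary ⟨_, this⟩).2
  refine ⟨hu, exp_apply_eq_self (by simp [h0]), fun i => ?_⟩
  have e : (Complex.I * (t : ℂ)) • L = t • (Complex.I • L) := by
    rw [mul_comm, mul_smul]
    exact Complex.coe_smul t (Complex.I • L)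
  rw [mul_assoc, e, exp_conj_eq_lin h r0 hr, ← mul_assoc, ← e, (Unitary.mem_iff.1 hu).1, one_mul]

theorem implements_exp_L3 (k t : ℝ) :
    Implements k (NormedSpace.exp ((Complex.I * (t : ℂ)) • L3 Λ)) (rot3 t) := by
  refine implements_exp star_L3 (by simp [L3_psi]) (L3_comm_x k) ?_ (fun t i j => ?_) t
  · ext i j; fin_cases i <;> fin_cases j <;> simp [rot3]
  · fin_cases i <;> fin_cases j <;>
      simp [rot3, gen3, Matrix.mul_apply, Fin.sum_univ_three, Real.hasDerivAt_sin,
        Real.hasDerivAt_cos, hasDerivAt_const, (Real.hasDerivAt_sin t).fun_neg]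

theorem implements_exp_L2 (k t : ℝ) :
    Implements k (NormedSpace.exp ((Complex.I * (t : ℂ)) • L2 Λ)) (rot2 t) := by
  refine implements_exp star_L2 ?_ (L2_comm_x k) ?_ (fun t i j => ?_) t
  · simp [L2, Lplus_psi, Lminus_psi, raiseCoef]
  · ext i j; fin_cases i <;> fin_cases j <;> simp [rot2]
  · fin_cases i <;> fin_cases j <;>
      simp [rot2, gen2, Matrix.mul_apply, Fin.sum_univ_three, Real.hasDerivAt_sin,
        Real.hasDerivAt_cos, hasDerivAt_const, (Real.hasDerivAt_sin t).fun_neg]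

/-- The operator `π_Λ(g)` implements `g`. -/
theorem implements_rep (k : ℝ) (g : SO3) : Implements k (rep Λ g) g.1 := by
  rw [eulerAngles_spec g]
  exact ((implements_exp_L3 k _).mul (implements_exp_L2 k _)).mul (implements_exp_L3 k _)

/-! ### `π_Λ` is a continuous unitary representation -/

theorem rep_mem_unitary (g : SO3) : rep Λ g ∈ unitary (Obs Λ) := (implements_rep 1 g).mem_unitary

theorem Implements.eq_rep {k : ℝ} (hk : 0 < k) {U : Obs Λ} {g : SO3} (h : Implements k U g.1) :
    U = rep Λ g := h.unique hk (implements_rep k g)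

theorem rep_mul (g h : SO3) : rep Λ (g * h) = rep Λ g * rep Λ h :=
  (Implements.eq_rep one_pos ((implements_rep 1 g).mul (implements_rep 1 h))).symm

theorem rep_exp_L3 (t : ℝ) : ∃ g : SO3,
    rep Λ g = NormedSpace.exp ((Complex.I * (t : ℂ)) • L3 Λ) :=
  ⟨⟨rot3 t, (Matrix.mem_orthogonalGroup_iff (Fin 3) ℝ).2
      ((congrArg _ (rot3_transpose t)).trans (rot3_mul_neg t)), rot3_det t⟩,
    ((implements_exp_L3 1 t).eq_rep one_pos).symm⟩

theorem rep_exp_L2 (t : ℝ) : ∃ g : SO3,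
    rep Λ g = NormedSpace.exp ((Complex.I * (t : ℂ)) • L2 Λ) :=
  ⟨⟨rot2 t, (Matrix.mem_orthogonalGroup_iff (Fin 3) ℝ).2
      ((congrArg _ (rot2_transpose t)).trans (rot2_mul_neg t)), rot2_det t⟩,
    ((implements_exp_L2 1 t).eq_rep one_pos).symm⟩

theorem isClosed_conj_eq_lin {A : Type*} [NormedRing A] [NormedAlgebra ℂ A] [StarRing A]
    [ContinuousStar A] (X : Fin 3 → A) (i : Fin 3) :
    IsClosed {p : Matrix (Fin 3) (Fin 3) ℝ × A | star p.2 * X i * p.2 = lin X p.1 i} := by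
  refine isClosed_eq (by fun_prop) ?_
  unfold lin
  refine continuous_finsetSum _ fun j _ => ?_
  have : Continuous fun p : Matrix (Fin 3) (Fin 3) ℝ × A => p.1 i j :=
    continuous_fst.matrix_elem i j
  fun_prop

theorem isCompact_unitary (A : Type*) [NormedRing A] [StarRing A] [CStarRing A] [ProperSpace A] :
    IsCompact (unitary A : Set A) := by
  nontriviality A
  refine (isCompact_closedBall (0 : A) 1).of_isClosed_subset isClosed_unitary fun U hU => ?_
  rw [mem_closedBall_zero_iff]
  exact (CStarRing.norm_of_mem_unitary hU).le

/-- The graph of `π_Λ` is closed, since it is the set of the pairs `(g, U)` such that `U` implements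
`g`, and the unitary group is compact. -/
theorem continuous_rep : Continuous (rep Λ) := by
  let f : SO3 → unitary (Obs Λ) := fun g => ⟨rep Λ g, rep_mem_unitary g⟩
  have : CompactSpace (unitary (Obs Λ)) := isCompact_iff_compactSpace.1 (isCompact_unitary (Obs Λ))
  have hgraph : IsClosed {p : SO3 × unitary (Obs Λ) | p.2 = f p.1} := by
    have e : {p : SO3 × unitary (Obs Λ) | p.2 = f p.1} =
        {p | (p.2 : Obs Λ) (psi Λ 0 0) = psi Λ 0 0} ∩
          ⋂ i, {p | star (p.2 : Obs Λ) * x Λ 1 i * (p.2 : Obs Λ) = lin (x Λ 1) p.1.1 i} := by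
      ext ⟨g, U⟩
      simp only [Set.mem_ofPred_eq, Set.mem_inter_iff, Set.mem_iInter]
      refine ⟨?_, fun h => Subtype.ext ?_⟩
      · rintro rfl
        exact ⟨(implements_rep 1 g).vacuum, (implements_rep 1 g).conj⟩
      · exact Implements.eq_rep one_pos ⟨U.2, h.1, h.2⟩
    rw [e]
    have h2 : Continuous fun p : SO3 × unitary (Obs Λ) => (p.2 : Obs Λ) :=
      continuous_subtype_val.comp continuous_snd
    have h1 : Continuous fun p : SO3 × unitary (Obs Λ) => (p.1.1 : Matrix (Fin 3) (Fin 3) ℝ) :=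
      continuous_subtype_val.comp continuous_fst
    exact (isClosed_eq (h2.clm_apply continuous_const) continuous_const).inter
      (isClosed_iInter fun i => (isClosed_conj_eq_lin (x Λ 1) i).preimage (h1.prodMk h2))
  have hf : Continuous f := by
    refine continuous_iff_isClosed.2 fun s hs => ?_
    have : f ⁻¹' s = Prod.fst '' ({p : SO3 × unitary (Obs Λ) | p.2 = f p.1} ∩ Prod.snd ⁻¹' s) := by
      ext g
      simp
    rw [this]
    exact isClosedMap_fst_of_compactSpace _ (hgraph.inter (hs.preimage continuous_snd))
  exact continuous_subtype_val.comp hf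

theorem continuous_coherent (ω : Hilb Λ) : Continuous (coherent Λ ω) :=
  continuous_rep.clm_apply continuous_const

theorem coherent_mul (ω : Hilb Λ) (g h : SO3) :
    coherent Λ ω (g * h) = rep Λ g (coherent Λ ω h) := by
  rw [coherent, rep_mul]; rfl

theorem commute_rep {S : Obs Λ} (hp : Commute S (Lplus Λ)) (hm : Commute S (Lminus Λ))
    (h3 : Commute S (L3 Λ)) (g : SO3) : Commute S (rep Λ g) := by
  have h2 : Commute S (L2 Λ) := (hp.sub_right hm).smul_right _
  let : NormedAlgebra ℚ (Obs Λ) := NormedAlgebra.restrictScalars ℚ ℂ (Obs Λ)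
  exact (((h3.smul_right _).exp_right).mul_right ((h2.smul_right _).exp_right)).mul_right
    ((h3.smul_right _).exp_right)

/-! ### Operators that commute with the representation -/

/-- Differentiation at `t = 0`. -/
theorem commute_of_commute_exp {A : Type*} [NormedRing A] [NormedAlgebra ℂ A] [CompleteSpace A]
    {T L : A} (h : ∀ t : ℝ, Commute T (NormedSpace.exp ((Complex.I * (t : ℂ)) • L))) :
    Commute T L := by
  have e : ∀ t : ℝ, (Complex.I * (t : ℂ)) • L = t • (Complex.I • L) := fun t => by
    rw [mul_comm, mul_smul]
    exact Complex.coe_smul t (Complex.I • L)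
  have h1 := (hasDerivAt_exp_smul_const (𝕂 := ℝ) (Complex.I • L) 0).const_mul T
  have h2 := (hasDerivAt_exp_smul_const (𝕂 := ℝ) (Complex.I • L) 0).mul_const T
  have h3 : (fun t : ℝ => T * NormedSpace.exp (t • (Complex.I • L))) =
      fun t : ℝ => NormedSpace.exp (t • (Complex.I • L)) * T := by
    funext t; rw [← e]; exact (h t).eq
  rw [h3] at h1
  have h4 := h1.unique h2
  simp only [zero_smul, NormedSpace.exp_zero, one_mul, mul_smul_comm, smul_mul_assoc] at h4
  exact smul_right_injective A Complex.I_ne_zero h4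

theorem L3_comm_Lplus : L3 Λ * Lplus Λ - Lplus Λ * L3 Λ = Lplus Λ :=
  obs_ext fun l m _ => by
    simp only [_root_.sub_apply, mul_apply_eq_comp, Lplus_psi, L3_psi, map_smul, smul_smul,
      ← sub_smul]
    congr 1; push_cast; ring

theorem L3_comm_Lminus : L3 Λ * Lminus Λ - Lminus Λ * L3 Λ = -Lminus Λ :=
  obs_ext fun l m _ => by
    simp only [_root_.sub_apply, _root_.neg_apply, mul_apply_eq_comp, Lminus_psi, L3_psi, map_smul,
      smul_smul, ← sub_smul, ← neg_smul]
    congr 1; push_cast; ring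

/-- What commutes with `L₃` and `L₂` commutes with `L₊` and `L₋`, since `[L₃, L₊ - L₋] = L₊ + L₋`. -/
theorem commute_raise_lower {A : Type*} [Ring A] [Algebra ℂ A] {T L₃ P M : A}
    (hP : L₃ * P - P * L₃ = P) (hM : L₃ * M - M * L₃ = -M) (h₃ : Commute T L₃)
    (h₂ : Commute T ((1 / (2 * Complex.I)) • (P - M))) : Commute T P ∧ Commute T M := by
  have hd : Commute T (P - M) := by
    have := h₂.smul_right (2 * Complex.I)
    rwa [smul_smul, mul_one_div_cancel (by simp), one_smul] at this
  have hs : Commute T (P + M) := by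
    have : P + M = L₃ * (P - M) - (P - M) * L₃ := by
      calc P + M = (L₃ * P - P * L₃) - (L₃ * M - M * L₃) := by rw [hP, hM, sub_neg_eq_add]
        _ = _ := by noncomm_ring
    rw [this]
    exact (h₃.mul_right hd).sub_right (hd.mul_right h₃)
  constructor
  · have : P = (1 / 2 : ℂ) • ((P + M) + (P - M)) := by module
    rw [this]; exact (hs.add_right hd).smul_right _
  · have : M = (1 / 2 : ℂ) • ((P + M) - (P - M)) := by module
    rw [this]; exact (hs.sub_right hd).smul_right _

theorem opOfBasis_diag_apply (d : ℤ → ℤ → ℂ) (v : Hilb Λ) (p : Idx Λ) :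
    opOfBasis Λ (fun l m => d l m • psi Λ l m) v p = d p.1 p.2 * v p := by
  simp only [opOfBasis, _root_.sum_apply, ContinuousLinearMap.smulRight_apply, psi_coe]
  rw [WithLp.ofLp_sum, Finset.sum_apply, Finset.sum_eq_single p]
  · simp [mul_comm]
  · intro q _ hq
    simp [hq.symm]
  · simp

/-- The Casimir operator `L₋ L₊ + L₃² + L₃` is `l (l + 1)` on `ψ_l^m`. -/
theorem casimir_eq : Lminus Λ * Lplus Λ + L3 Λ * L3 Λ + L3 Λ =
    opOfBasis Λ fun l m => ((l * (l + 1) : ℤ) : ℂ) • psi Λ l m :=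
  obs_ext fun l m h => by
    rw [opOfBasis_psi fun h' => absurd h h']
    simp only [_root_.add_apply, mul_apply_eq_comp, Lplus_psi, Lminus_psi, L3_psi, map_smul,
      smul_smul, add_sub_cancel_right, ← add_smul]
    have e : raiseCoef l (-(m + 1)) = raiseCoef l m := by
      unfold raiseCoef; congr 2; ring
    have e' : raiseCoef l m * raiseCoef l m = ((l - m) * (l + m + 1) : ℤ) :=
      mul_self_sqrt_intCast (mul_nonneg (by linarith [h.2.2.2]) (by linarith [h.2.2.1]))
    have e'' := congrArg ((↑) : ℝ → ℂ) e'
    rw [e]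
    congr 1
    push_cast at e'' ⊢
    linear_combination e''

/-- Schur's lemma for `π_Λ`, whose irreducible components `V_l` are pairwise inequivalent:
the joint eigenspaces of `L₃` and the Casimir operator are the lines of the `ψ_l^m`, and `L₊`
connects those with the same `l`. -/
theorem exists_scalar_of_commute_rep {T : Obs Λ} (hT : ∀ g, Commute T (rep Λ g)) :
    ∃ τ : ℤ → ℂ, ∀ l m, InRange Λ l m → T (psi Λ l m) = τ l • psi Λ l m := by
  have h3 : Commute T (L3 Λ) := commute_of_commute_exp fun t => by
    obtain ⟨g, hg⟩ := rep_exp_L3 (Λ := Λ) t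
    rw [← hg]; exact hT g
  have h2 : Commute T (L2 Λ) := commute_of_commute_exp fun t => by
    obtain ⟨g, hg⟩ := rep_exp_L2 (Λ := Λ) t
    rw [← hg]; exact hT g
  obtain ⟨hp, hm⟩ := commute_raise_lower L3_comm_Lplus L3_comm_Lminus h3 h2
  have hC := ((hm.mul_right hp).add_right (h3.mul_right h3)).add_right h3
  rw [casimir_eq] at hC
  have hdiag : ∀ (d : ℤ → ℤ → ℂ), Commute T (opOfBasis Λ fun l m => d l m • psi Λ l m) →
      ∀ p q : Idx Λ, d p.1 p.2 ≠ d q.1 q.2 → T (psi Λ q.1 q.2) p = 0 := fun d hd p q hpq => by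
    have h := congrArg (fun S : Obs Λ => S (psi Λ q.1 q.2) p) hd.eq
    simp only [mul_apply_eq_comp] at h
    rw [opOfBasis_psi fun h' => absurd (inRange_coe q) h', opOfBasis_diag_apply, map_smul,
      PiLp.smul_apply, smul_eq_mul] at h
    exact (mul_eq_mul_right_iff.1 h).resolve_left hpq.symm
  let σ : ℤ → ℤ → ℂ := fun l m => inner ℂ (psi Λ l m) (T (psi Λ l m))
  have hσ : ∀ l m, InRange Λ l m → T (psi Λ l m) = σ l m • psi Λ l m := fun l m h => by
    obtain ⟨q, rfl, rfl⟩ := exists_idx h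
    ext p
    rw [PiLp.smul_apply, psi_apply]
    split_ifs with hpq
    · rw [idx_ext hpq.1 hpq.2, smul_eq_mul, mul_one]
      exact (inner_psi_left h _ q rfl rfl).symm
    · rw [smul_zero]
      by_cases hm' : (p.2 : ℤ) = q.2
      · refine hdiag (fun l _ => ((l * (l + 1) : ℤ) : ℂ)) hC p q fun e => hpq ⟨?_, hm'⟩
        have e' : (p.1 : ℤ) * (p.1 + 1) = q.1 * (q.1 + 1) := by exact_mod_cast e
        have h1 := (inRange_coe p).1
        have h2 := (inRange_coe q).1
        nlinarith
      · exact hdiag (fun _ m => (m : ℂ)) h3 p q fun e => hm' (by exact_mod_cast e)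
  have hstep : ∀ l m, InRange Λ l m → InRange Λ l (m + 1) → σ l (m + 1) = σ l m := by
    intro l m h h'
    have h4 := congrArg (fun S : Obs Λ => S (psi Λ l m)) hp.eq
    simp only [mul_apply_eq_comp, Lplus_psi, map_smul, hσ _ _ h, hσ _ _ h', smul_smul] at h4
    have h5 := congrArg (inner ℂ (psi Λ l (m + 1))) h4
    rw [inner_smul_right, inner_smul_right, inner_psi_psi h', if_pos ⟨rfl, rfl⟩, mul_one, mul_one,
      mul_comm] at h5
    refine mul_right_cancel₀ ?_ h5
    have : 0 < raiseCoef l m := Real.sqrt_pos.2 (Int.cast_pos.2 (mul_pos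
      (by linarith [h'.2.2.2]) (by linarith [h.2.2.1])))
    exact_mod_cast this.ne'
  have hconst : ∀ l, ∀ n : ℕ, InRange Λ l (-l + n) → σ l (-l + n) = σ l (-l) := by
    intro l n
    induction n with
    | zero => intro _; simp
    | succ n ih =>
      intro h
      have h' : InRange Λ l (-l + n) := by unfold InRange at *; push_cast at h; omega
      have e : -l + ((n + 1 : ℕ) : ℤ) = -l + n + 1 := by push_cast; ring
      rw [e] at h ⊢
      rw [hstep _ _ h' h, ih h']
  refine ⟨fun l => σ l (-l), fun l m h => ?_⟩
  obtain ⟨n, hn⟩ := Int.eq_ofNat_of_zero_le (by linarith [h.2.2.1] : 0 ≤ m + l)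
  obtain rfl : m = -l + n := by linarith
  rw [hσ _ _ h, hconst l n h]

/-! ### The resolution of the identity -/

theorem invMeasure_univ : invMeasure Set.univ = ENNReal.ofReal (8 * Real.pi ^ 2) := by
  have : Measure.haarMeasure (⊤ : TopologicalSpace.PositiveCompacts SO3) Set.univ = 1 :=
    Measure.haarMeasure_self
  rw [invMeasure, Measure.smul_apply, this, smul_eq_mul, mul_one]

instance : IsFiniteMeasure invMeasure := ⟨by rw [invMeasure_univ]; exact ENNReal.ofReal_lt_top⟩

instance : invMeasure.IsMulLeftInvariant := by
  unfold invMeasure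
  infer_instance

theorem integral_const_invMeasure (c : ℂ) :
    ∫ _ : SO3, c ∂invMeasure = (8 * Real.pi ^ 2 : ℝ) * c := by
  rw [integral_const, Measure.real, invMeasure_univ, ENNReal.toReal_ofReal (by positivity),
    Complex.real_smul]

theorem conj_proj (U : Obs Λ) (v : Hilb Λ) : U * proj v * star U = proj (U v) := by
  ext1 z
  rw [mul_apply_eq_comp, mul_apply_eq_comp, proj, proj, InnerProductSpace.rankOne_apply,
    InnerProductSpace.rankOne_apply, map_smul, ContinuousLinearMap.star_eq_adjoint,
    ContinuousLinearMap.adjoint_inner_right]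

theorem continuous_conj {A G : Type*} [TopologicalSpace G] [NormedRing A] [StarRing A]
    [ContinuousStar A] {f : G → A} (hf : Continuous f) (B : A) :
    Continuous fun g => f g * B * star (f g) := by
  fun_prop

theorem continuous_proj_coherent (ω : Hilb Λ) : Continuous fun g => proj (coherent Λ ω g) := by
  have h := continuous_conj (continuous_rep (Λ := Λ)) (proj ω)
  simp only [conj_proj] at h
  exact h

theorem integrable_proj_coherent (ω : Hilb Λ) :
    Integrable (fun g => proj (coherent Λ ω g)) invMeasure :=
  (continuous_proj_coherent ω).integrable_of_hasCompactSupport (HasCompactSupport.of_compactSpace _)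

/-- The operator `∫ P_g dμ(g)`. -/
def frame (ω : Hilb Λ) : Obs Λ := ∫ g, proj (coherent Λ ω g) ∂invMeasure

theorem conj_integral {A G : Type*} [NormedRing A] [NormedAlgebra ℂ A] [CompleteSpace A]
    [MeasurableSpace G] {μ : Measure G} (U V : A) {f : G → A} (hf : Integrable f μ) :
    U * (∫ g, f g ∂μ) * V = ∫ g, U * f g * V ∂μ := by
  rw [← integral_const_mul_of_integrable hf, integral_mul_const_of_integrable (hf.const_mul U)]

/-- By the invariance of the measure, the frame operator commutes with the representation. -/
theorem commute_frame_rep (ω : Hilb Λ) (h : SO3) : Commute (frame ω) (rep Λ h) := by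
  have key : rep Λ h * frame ω * star (rep Λ h) = frame ω := by
    have h1 := integral_mul_left_eq_self (μ := invMeasure) (fun g => proj (coherent Λ ω g)) h
    simp only [coherent_mul, ← conj_proj] at h1
    exact (conj_integral _ _ (integrable_proj_coherent ω)).trans h1
  have hu := (Unitary.mem_iff.1 (rep_mem_unitary (Λ := Λ) h)).1
  calc frame ω * rep Λ h = rep Λ h * frame ω * (star (rep Λ h) * rep Λ h) := by
        rw [← mul_assoc, key]
    _ = rep Λ h * frame ω := by rw [hu, mul_one]

/-- The Bochner integral commutes with the continuous linear map `S ↦ ⟨v, S v⟩`. -/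
theorem inner_frame (ω v : Hilb Λ) :
    inner ℂ v (frame ω v) = ∫ g, ((‖inner ℂ v (coherent Λ ω g)‖ ^ 2 : ℝ) : ℂ) ∂invMeasure := by
  have h := ((innerSL ℂ v).comp (ContinuousLinearMap.apply ℂ (Hilb Λ) v)).integral_comp_comm
    (integrable_proj_coherent ω)
  refine Eq.trans ?_ (h.symm.trans ?_)
  · rfl
  · refine integral_congr_ae (.of_forall fun g => ?_)
    simp only [ContinuousLinearMap.comp_apply, ContinuousLinearMap.apply_apply, innerSL_apply_apply,
      proj, InnerProductSpace.rankOne_apply, inner_smul_right]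
    rw [← inner_conj_symm, mul_comm, Complex.mul_conj']
    push_cast; rfl

/-- The orthogonal projector on the component `V_l`, the span of the `ψ_l^m` with `l` fixed. -/
def levelProj (Λ : ℕ) (l : ℤ) : Obs Λ :=
  ∑ m ∈ Finset.Icc (-l) l, proj (psi Λ l m)

theorem levelProj_psi (l : ℤ) (l' m' : ℤ) :
    levelProj Λ l (psi Λ l' m') = if l = l' then psi Λ l' m' else 0 := by
  by_cases h : InRange Λ l' m'
  · simp only [levelProj, _root_.sum_apply, proj, InnerProductSpace.rankOne_apply,
      inner_psi_psi_of_right h]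
    split_ifs with e
    · subst e
      rw [Finset.sum_eq_single m']
      · simp
      · intro b _ hb; simp [hb]
      · intro hm
        exact absurd (Finset.mem_Icc.2 h.2.2) hm
    · refine Finset.sum_eq_zero fun m _ => ?_
      simp [e]
  · simp [psi_eq_zero h]

theorem inner_levelProj (l : ℤ) (v : Hilb Λ) : inner ℂ v (levelProj Λ l v) =
    ((∑ m ∈ Finset.Icc (-l) l, ‖inner ℂ (psi Λ l m) v‖ ^ 2 : ℝ) : ℂ) := by
  simp only [levelProj, _root_.sum_apply, inner_sum, proj, InnerProductSpace.rankOne_apply,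
    inner_smul_right]
  push_cast
  refine Finset.sum_congr rfl fun m _ => ?_
  rw [← inner_conj_symm v, Complex.mul_conj']

theorem commute_levelProj_rep (l : ℤ) (g : SO3) : Commute (levelProj Λ l) (rep Λ g) := by
  refine commute_rep (obs_ext fun l' m _ => ?_) (obs_ext fun l' m _ => ?_)
    (obs_ext fun l' m _ => ?_) g <;>
  · simp only [mul_apply_eq_comp, Lplus_psi, Lminus_psi, L3_psi, levelProj_psi, map_smul]
    split_ifs <;> simp [Lplus_psi, Lminus_psi, L3_psi]

/-- The weight of `ω_g` in the component `V_l` does not depend on `g`. -/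
theorem sum_norm_inner_coherent (ω : Hilb Λ) (l : ℤ) (g : SO3) :
    ∑ m ∈ Finset.Icc (-l) l, ‖inner ℂ (psi Λ l m) (coherent Λ ω g)‖ ^ 2 =
      ∑ m ∈ Finset.Icc (-l) l, ‖inner ℂ (psi Λ l m) ω‖ ^ 2 := by
  have h : inner ℂ (coherent Λ ω g) (levelProj Λ l (coherent Λ ω g)) =
      inner ℂ ω (levelProj Λ l ω) := by
    have hc := congrArg (fun S : Obs Λ => S ω) (commute_levelProj_rep (Λ := Λ) l g).eq
    simp only [mul_apply_eq_comp] at hc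
    rw [coherent, hc]
    exact ContinuousLinearMap.inner_map_map_of_mem_unitary (rep_mem_unitary g) _ _
  rw [inner_levelProj, inner_levelProj] at h
  exact_mod_cast h

theorem inner_psi_vec (w : ℤ → ℤ → ℂ) {l m : ℤ} (h : InRange Λ l m) :
    inner ℂ (psi Λ l m) (vec Λ w) = w l m := by
  simp only [vec, inner_sum, inner_smul_right, inner_psi_psi h]
  rw [Finset.sum_eq_single l, Finset.sum_eq_single m]
  · simp
  · intro b _ hb; simp [hb.symm]
  · intro hm; exact absurd (Finset.mem_Icc.2 h.2.2) hm
  · intro b _ hb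
    exact Finset.sum_eq_zero fun _ _ => by simp [hb.symm]
  · intro hl; exact absurd (Finset.mem_Icc.2 ⟨h.1, h.2.1⟩) hl

theorem frame_eq {w : ℤ → ℤ → ℂ}
    (hw : ∀ l ∈ Finset.Icc (0 : ℤ) (Λ : ℤ),
      ∑ h ∈ Finset.Icc (-l) l, ‖w l h‖ ^ 2 = (2 * (l : ℝ) + 1) / ((Λ : ℝ) + 1) ^ 2) :
    (1 : Obs Λ) = (((Λ : ℝ) + 1) ^ 2 / (8 * Real.pi ^ 2)) • frame (vec Λ w) := by
  obtain ⟨τ, hτ⟩ := exists_scalar_of_commute_rep (commute_frame_rep (vec Λ w))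
  refine obs_ext fun l m h => ?_
  have hl : 0 ≤ l := h.1
  have hr : ∀ m' ∈ Finset.Icc (-l) l, InRange Λ l m' := fun m' hm' =>
    ⟨h.1, h.2.1, Finset.mem_Icc.1 hm'⟩
  -- the trace of the frame operator over `V_l`, computed in two ways
  have h1 : ∑ m' ∈ Finset.Icc (-l) l, inner ℂ (psi Λ l m') (frame (vec Λ w) (psi Λ l m')) =
      (2 * l + 1) * τ l := by
    have : ∀ m' ∈ Finset.Icc (-l) l,
        inner ℂ (psi Λ l m') (frame (vec Λ w) (psi Λ l m')) = τ l := fun m' hm' => by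
      rw [hτ _ _ (hr m' hm'), inner_smul_right, inner_psi_psi (hr m' hm'), if_pos ⟨rfl, rfl⟩,
        mul_one]
    rw [Finset.sum_congr rfl this, Finset.sum_const, Int.card_Icc, nsmul_eq_mul]
    congr 1
    have : ((l + 1 - -l).toNat : ℤ) = 2 * l + 1 := by omega
    exact_mod_cast congrArg ((↑) : ℤ → ℂ) this
  have h2 : ∑ m' ∈ Finset.Icc (-l) l, inner ℂ (psi Λ l m') (frame (vec Λ w) (psi Λ l m')) =
      (8 * Real.pi ^ 2 : ℝ) * ((2 * (l : ℝ) + 1) / ((Λ : ℝ) + 1) ^ 2 : ℝ) := by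
    simp only [inner_frame]
    rw [← integral_finsetSum, ← integral_const_invMeasure]
    · refine integral_congr_ae (.of_forall fun g => ?_)
      simp only [← Complex.ofReal_sum]
      rw [sum_norm_inner_coherent, ← hw l (Finset.mem_Icc.2 ⟨h.1, h.2.1⟩)]
      congr 1
      exact Finset.sum_congr rfl fun m' hm' => by rw [inner_psi_vec w (hr m' hm')]
    · intro m' _
      refine Continuous.integrable_of_hasCompactSupport ?_ (HasCompactSupport.of_compactSpace _)
      have := continuous_coherent (vec Λ w)
      fun_prop
  have h3 : τ l = (8 * Real.pi ^ 2 / ((Λ : ℝ) + 1) ^ 2 : ℝ) := by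
    have hl' : (2 * (l : ℂ) + 1) ≠ 0 := by exact_mod_cast (by omega : 2 * l + 1 ≠ 0)
    refine mul_left_cancel₀ hl' (h1.symm.trans (h2.trans ?_))
    push_cast
    ring
  rw [one_apply_eq_self, _root_.smul_apply, hτ _ _ h, h3, ← Complex.coe_smul, smul_smul,
    ← Complex.ofReal_mul]
  have h4 : ((Λ : ℝ) + 1) ^ 2 / (8 * Real.pi ^ 2) * (8 * Real.pi ^ 2 / ((Λ : ℝ) + 1) ^ 2) = 1 := by
    have : (Λ : ℝ) + 1 ≠ 0 := by positivity
    have := Real.pi_ne_zero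
    field_simp
  rw [h4, Complex.ofReal_one, one_smul]

/-! ### Equivariance -/

theorem star_parity : star (parity Λ) = parity Λ :=
  obs_ext_inner fun l m l' m' h h' => by
    rw [ContinuousLinearMap.star_eq_adjoint, ContinuousLinearMap.adjoint_inner_right, parity_psi,
      parity_psi, inner_smul_left, inner_smul_right, inner_psi_psi h]
    by_cases e : l = l' ∧ m = m'
    · obtain ⟨rfl, rfl⟩ := e
      simp
    · rw [if_neg e]; simp

theorem star_flip : star (flip Λ) = flip Λ :=
  obs_ext_inner fun l m l' m' h h' => by
    rw [ContinuousLinearMap.star_eq_adjoint, ContinuousLinearMap.adjoint_inner_right, flip_psi,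
      flip_psi, inner_smul_left, inner_smul_right, inner_psi_psi h, inner_psi_psi_of_right h']
    by_cases e : l = l' ∧ -m = m'
    · obtain ⟨rfl, rfl⟩ := e
      simp
    · rw [if_neg e, if_neg (by omega)]; simp

theorem mem_unitary_of_involution {A : Type*} [Monoid A] [StarMul A] {J : A} (h : star J = J)
    (hJ : J * J = 1) : J ∈ unitary A := Unitary.mem_iff.2 (by rw [h]; exact ⟨hJ, hJ⟩)

theorem commute_parity_rep (g : SO3) : Commute (parity Λ) (rep Λ g) := by
  refine commute_rep (obs_ext fun l m _ => ?_) (obs_ext fun l m _ => ?_)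
    (obs_ext fun l m _ => ?_) g <;>
  simp only [mul_apply_eq_comp, Lplus_psi, Lminus_psi, L3_psi, parity_psi, map_smul, smul_smul,
    mul_comm]

theorem parity_conj_x (k : ℝ) (i : Fin 3) : parity Λ * x Λ k i * parity Λ = -x Λ k i := by
  have key : ∀ {A : Type} [Ring A] [Algebra ℂ A] {J X : A}, J * J = 1 → J * X = -(X * J) →
      J * X * J = -X := fun hJ h => by rw [h, neg_mul, mul_assoc, hJ, mul_one]
  have hc : ∀ a : ℤ, a = 0 ∨ a = 1 ∨ a = -1 → parity Λ * xa Λ k a = -(xa Λ k a * parity Λ) :=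
    fun a ha => parity_mul_xa k ha
  have lincomb : ∀ {A : Type} [Ring A] [Algebra ℂ A] {J X Y : A} (c : ℂ), J * X = -(X * J) →
      J * Y = -(Y * J) → J * c • (X + Y) = -(c • (X + Y) * J) ∧
        J * c • (X - Y) = -(c • (X - Y) * J) := fun c h₁ h₂ => by
    simp only [mul_smul_comm, smul_mul_assoc, mul_add, mul_sub, add_mul, sub_mul, h₁, h₂]
    constructor <;> module
  refine key parity_mul_parity ?_
  match i with
  | 0 => exact (lincomb _ (hc 1 (by simp)) (hc (-1) (by simp))).1
  | 1 => exact (lincomb _ (hc 1 (by simp)) (hc (-1) (by simp))).2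
  | 2 => exact hc 0 (by simp)

/-- The rotation by `π` around the first axis. -/
def halfTurn : SO3 :=
  ⟨Matrix.diagonal ![1, -1, -1], (Matrix.mem_orthogonalGroup_iff (Fin 3) ℝ).2 (by
    change Matrix.diagonal ![1, -1, -1] * (Matrix.diagonal ![1, -1, -1])ᵀ = 1
    ext i j; fin_cases i <;> fin_cases j <;> simp [Matrix.diagonal_transpose]),
    by change (Matrix.diagonal ![1, -1, -1]).det = 1; simp [Fin.prod_univ_three]⟩

theorem involution_conj_eq_lin {A : Type*} [Ring A] [Algebra ℂ A] {J X₀ X₁ X₂ : A}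
    {X : Fin 3 → A} (x₀ : X 0 = (1 / 2 : ℂ) • (X₁ + X₂))
    (x₁ : X 1 = (1 / (2 * Complex.I)) • (X₁ - X₂)) (x₂ : X 2 = X₀)
    (j₀ : J * X₀ * J = -X₀) (j₁ : J * X₁ * J = X₂) (j₂ : J * X₂ * J = X₁) (i : Fin 3) :
    J * X i * J = lin X (Matrix.diagonal ![1, -1, -1]) i := by
  have e : lin X (Matrix.diagonal ![1, -1, -1]) 0 = X 0 ∧
      lin X (Matrix.diagonal ![1, -1, -1]) 1 = -X 1 ∧
      lin X (Matrix.diagonal ![1, -1, -1]) 2 = -X 2 := by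
    simp [lin, Matrix.diagonal_apply]
  obtain ⟨e₀, e₁, e₂⟩ := e
  match i with
  | 0 =>
    rw [e₀, x₀, mul_smul_comm, smul_mul_assoc, mul_add, add_mul, j₁, j₂, add_comm]
  | 1 =>
    rw [e₁, x₁, mul_smul_comm, smul_mul_assoc, mul_sub, sub_mul, j₁, j₂]; module
  | 2 => rw [e₂, x₂, j₀]

theorem rep_halfTurn : rep Λ halfTurn = flip Λ := by
  refine (Implements.eq_rep (k := 1) one_pos ⟨?_, ?_, fun i => ?_⟩).symm
  · exact mem_unitary_of_involution star_flip flip_mul_flip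
  · simp [flip_psi]
  · rw [star_flip]
    exact involution_conj_eq_lin (X := x Λ 1) rfl rfl rfl (flip_conj_x0 1) (flip_conj_x1 1)
      (flip_conj_xneg 1) i

/-- If `ω_l^h = ω_l^{-h}`, the inversion acts on `ω` as a rotation does. -/
theorem parity_vec {w : ℤ → ℤ → ℂ}
    (h : ∀ l ∈ Finset.Icc (0 : ℤ) (Λ : ℤ), ∀ h ∈ Finset.Icc (-l) l, w l h = w l (-h)) :
    parity Λ (vec Λ w) = rep Λ halfTurn (vec Λ w) := by
  rw [rep_halfTurn]
  simp only [vec, map_sum, map_smul, parity_psi, flip_psi]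
  refine Finset.sum_congr rfl fun l hl => ?_
  refine Finset.sum_nbij' (fun m => -m) (fun m => -m) ?_ ?_ ?_ ?_ ?_
  · intro m hm; simp only [Finset.mem_Icc] at hm ⊢; omega
  · intro m hm; simp only [Finset.mem_Icc] at hm ⊢; omega
  · simp
  · simp
  · intro m hm
    rw [h l hl m hm, neg_neg]

theorem image_rep_range (ω : Hilb Λ) (g : SO3) :
    rep Λ g '' Set.range (coherent Λ ω) = Set.range (coherent Λ ω) := by
  rw [← Set.range_comp]
  have : (rep Λ g) ∘ coherent Λ ω = coherent Λ ω ∘ (g * ·) := by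
    funext h; exact (coherent_mul ω g h).symm
  rw [this]
  exact (Group.mulLeft_bijective g).surjective.range_comp _

/-- The inversion maps `ω_g` to `ω_{gr}`, where `r` is the half turn. -/
theorem image_parity_range {ω : Hilb Λ} (h : parity Λ ω = rep Λ halfTurn ω) :
    parity Λ '' Set.range (coherent Λ ω) = Set.range (coherent Λ ω) := by
  rw [← Set.range_comp]
  have : (parity Λ) ∘ coherent Λ ω = coherent Λ ω ∘ (· * halfTurn) := by
    funext g
    have hc := congrArg (fun S : Obs Λ => S ω) (commute_parity_rep (Λ := Λ) g).eq
    simp only [mul_apply_eq_comp, h] at hc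
    exact hc.trans (coherent_mul ω g halfTurn).symm
  rw [this]
  exact (Group.mulRight_bijective halfTurn).surjective.range_comp _

theorem lin_neg_neg {A : Type*} [AddCommGroup A] [Module ℂ A] (X : Fin 3 → A)
    (M : Matrix (Fin 3) (Fin 3) ℝ) (i : Fin 3) : lin (fun j => -X j) (-M) i = lin X M i := by
  simp [lin]

theorem isFullyO3Equivariant {k : ℝ} {ω : Hilb Λ} (h : parity Λ ω = rep Λ halfTurn ω) :
    IsFullyO3Equivariant Λ k (Set.range (coherent Λ ω)) := by
  intro R
  unfold repO3
  split_ifs with hR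
  · exact ⟨rep_mem_unitary _, (implements_rep k _).conj, image_rep_range ω _⟩
  · refine ⟨mul_mem (rep_mem_unitary _)
      (mem_unitary_of_involution star_parity parity_mul_parity), fun i => ?_, ?_⟩
    · generalize hg : (⟨-R.1, R.neg_mem_SO3 hR⟩ : SO3) = g
      have hg' : g.1 = -R.1 := by rw [← hg]
      calc star (rep Λ g * parity Λ) * x Λ k i * (rep Λ g * parity Λ)
          = parity Λ * (star (rep Λ g) * x Λ k i * rep Λ g) * parity Λ := by
            rw [star_mul, star_parity]; simp only [mul_assoc]
        _ = lin (x Λ k) R.1 i := by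
            rw [(implements_rep k g).conj, conj_lin, hg']
            simp only [parity_conj_x]
            exact lin_neg_neg _ _ _
    · exact (Set.image_comp _ (parity Λ) _).trans
        ((congrArg _ (image_parity_range h)).trans (image_rep_range ω _))

end FuzzySphere

end

theorem theorem3 (Λ : ℕ) (k : ℝ) (hk : 0 < k) (w : ℤ → ℤ → ℂ)
    (hw : ∀ l ∈ Finset.Icc (0 : ℤ) (Λ : ℤ),
      ∑ h ∈ Finset.Icc (-l) l, ‖w l h‖ ^ 2 = (2 * (l : ℝ) + 1) / ((Λ : ℝ) + 1) ^ 2) :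
    -- the coherent states depend continuously on the rotation
    Continuous (FuzzySphere.coherent Λ (FuzzySphere.vec Λ w)) ∧
    -- resolution of the identity
    MeasureTheory.Integrable
      (fun g => FuzzySphere.proj (FuzzySphere.coherent Λ (FuzzySphere.vec Λ w) g))
      FuzzySphere.invMeasure ∧
    (1 : FuzzySphere.Obs Λ) = (((Λ : ℝ) + 1) ^ 2 / (8 * Real.pi ^ 2)) •
      ∫ g, FuzzySphere.proj (FuzzySphere.coherent Λ (FuzzySphere.vec Λ w) g)
        ∂FuzzySphere.invMeasure ∧
    -- equivariance under all orthogonal transformations in the symmetric case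
    ((∀ l ∈ Finset.Icc (0 : ℤ) (Λ : ℤ), ∀ h ∈ Finset.Icc (-l) l, w l h = w l (-h)) →
      FuzzySphere.IsFullyO3Equivariant Λ k
        (Set.range (FuzzySphere.coherent Λ (FuzzySphere.vec Λ w)))) :=
  ⟨FuzzySphere.continuous_coherent _, FuzzySphere.integrable_proj_coherent _,
    FuzzySphere.frame_eq hw, fun h => FuzzySphere.isFullyO3Equivariant (FuzzySphere.parity_vec h)⟩
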